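/- A closed system of rays is a nonempty family of closed rays in $\mathbb C$ issuing from $0$ whose union $S$ is a closed subset of $\mathbb C$; the connected components of $\mathbb C\setminus S$ are open angles $\angle(\alpha,\beta)=\{re^{i\theta}: r>0,\ \alpha<\theta<\beta\}$ with $\alpha<\beta\le\alpha+2\pi$, called the angles complementary to $S$. For $z\in\mathbb C$ and a Borel set $B\subset\mathbb C$ let $\omega(z,B;\mathbb C\setminus S)$ be the harmonic measure of $B\cap\partial\angle(\alpha,\beta)$ at $z$ for the domain $\angle(\alpha,\beta)$ if $z$ lies in the complementary angle $\angle(\alpha,\beta)$, and $\delta_z(B)$ if $z\in S$. Write $D(r)=\{|z|<r\}$. For $p\ge 0$, a positive Borel measure $\mu$ on $\mathbb C$, finite on compact sets, has finite type at order $p$ if $$\limsup_{r\to+\infty}\frac{\mu(\overline{D}(r))}{r^p}<+\infty .$$ A positive Borel measure $\nu$ on $\mathbb C$, finite on compact sets, satisfies the Blaschke condition (near infinity) in $\angle(\alpha,\beta)$ if for some $r_0>0$ $$\int_{\angle(\alpha,\beta)\setminus D(r_0)}-\operatorname{Im}\frac{1}{(ze^{-i\alpha})^{\pi/(\beta-\alpha)}}\,d\nu(z)<+\infty,$$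 where $(re^{i\theta})^{\kappa}=r^{\kappa}e^{i\kappa\theta}$ for $0<\theta<2\pi$; it satisfies the Blaschke condition outside $S$ if it does so in every angle complementary to $S$. The balayage $\nu_S^{\rm bal}$ of $\nu$ onto $S$ exists if there is a Borel measure $\nu_S^{\rm bal}$, finite on compact sets, with $\nu_S^{\rm bal}(B)=\int_{\mathbb C}\omega(z,B;\mathbb C\setminus S)\,d\nu(z)$ for all Borel $B\subset\mathbb C$. Theorem. Let $S$ be a closed system of rays, $p\ge0$, and let $\nu$ be a positive Borel measure on $\mathbb C$, finite on compact sets, of finite type at order $p$. Then there are at most $2p$ angles complementary to $S$ of opening $\beta-\alpha\ge\pi/p$ (none if $p=0$), and the following four statements are equivalent: (i) $\int_{\mathbb C}\omega(z,D(r_0);\mathbb C\setminus S)\,d\nu(z)<+\infty$ for some $r_0>0$; (ii) $\nu$ satisfies the Blaschke condition in each angle $\angle(\alpha,\beta)$ complementary to $S$ of opening $\beta-\alpha\ge\pi/p$; (iii) $\nu$ satisfies the Blaschke condition outside $S$; (iv) the balayage $\nu_S^{\rm bal}$ exists and has finite type at order $p$. -/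

import Mathlib

open MeasureTheory Filter Topology

noncomputable section

namespace Balayage

/-! ### Systems of rays and their complementary angles -/

/-- The closed ray from the origin in the direction `u`. -/
def ray (u : Circle) : Set ℂ := {z | ∃ t : ℝ, 0 ≤ t ∧ z = (t : ℂ) * (u : ℂ)}

/-- `S` is (the point set of) a nonempty closed system of rays issuing from the origin. -/
def IsClosedRaySystem (S : Set ℂ) : Prop :=
  IsClosed S ∧ ∃ Θ : Set Circle, Θ.Nonempty ∧ S = ⋃ u ∈ Θ, ray u

/-- The open angle `∠(α, β)` with vertex at the origin. -/
def openAngle (α β : ℝ) : Set ℂ :=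
  {z | ∃ r θ : ℝ, 0 < r ∧ α < θ ∧ θ < β ∧ z = (r : ℂ) * Complex.exp ((θ : ℂ) * Complex.I)}

/-- `∠(α, β)`, with `α < β ≤ α + 2π`, is an angle complementary to `S`, that is, a connected
component of the complement of `S`. -/
def IsComplementaryAngle (S : Set ℂ) (α β : ℝ) : Prop :=
  α < β ∧ β ≤ α + 2 * Real.pi ∧ ∃ z ∈ Sᶜ, openAngle α β = connectedComponentIn Sᶜ z

/-! ### Harmonic measure through Perron functions

The boundary of a plane set is taken in the Riemann sphere `OnePoint ℂ`. -/

instance instMeasurableSpaceSphere : MeasurableSpace (OnePoint ℂ) := borel (OnePoint ℂ)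

instance instBorelSpaceSphere : BorelSpace (OnePoint ℂ) := ⟨rfl⟩

/-- The boundary in the Riemann sphere of a plane set `D`. -/
def sphereBoundary (D : Set ℂ) : Set (OnePoint ℂ) :=
  frontier ((fun z : ℂ => (z : OnePoint ℂ)) '' D)

/-- `u` is subharmonic on the open set `D`: it is upper semicontinuous with values in `[-∞, ∞)`
and satisfies the local submean inequality. The mean of the upper semicontinuous function `u`
over a circle, which may be `-∞`, is the infimum of the means of its continuous real majorants
on that circle. -/
def IsSubharmonicOn (u : ℂ → EReal) (D : Set ℂ) : Prop :=
  UpperSemicontinuousOn u D ∧ (∀ z ∈ D, u z < ⊤) ∧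
    ∀ z ∈ D, ∃ ρ : ℝ, 0 < ρ ∧ Metric.ball z ρ ⊆ D ∧ ∀ r : ℝ, 0 < r → r < ρ →
      ∀ φ : ℂ → ℝ, ContinuousOn φ (Metric.sphere z r) →
        (∀ w ∈ Metric.sphere z r, u w ≤ (φ w : EReal)) →
          u z ≤ ((Real.circleAverage φ z r : ℝ) : EReal)

/-- `limsup u(z') ≤ f(ζ)` as `z' → ζ` in `D`, for every boundary point `ζ` of `D`. -/
def BoundaryLE (D : Set ℂ) (u : ℂ → EReal) (f : OnePoint ℂ → ℝ) : Prop :=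
  ∀ ζ ∈ sphereBoundary D,
    limsup u (comap (fun z : ℂ => (z : OnePoint ℂ)) (𝓝 ζ) ⊓ 𝓟 D) ≤ (f ζ : EReal)

/-- The Perron function of the boundary data `f` on `D`. -/
def perron (D : Set ℂ) (f : OnePoint ℂ → ℝ) (z : ℂ) : EReal :=
  sSup {y | ∃ u : ℂ → EReal, IsSubharmonicOn u D ∧ BoundaryLE D u f ∧ y = u z}

/-- `μ` is the harmonic measure of `D` at `z`: a finite Borel measure on the boundary of `D`
against which every continuous function on the boundary integrates to its Perron function. -/
def IsHarmonicMeasure (D : Set ℂ) (z : ℂ) (μ : Measure (OnePoint ℂ)) : Prop :=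
  IsFiniteMeasure μ ∧ μ (sphereBoundary D)ᶜ = 0 ∧
    ∀ f : OnePoint ℂ → ℝ, ContinuousOn f (sphereBoundary D) →
      ((∫ w in sphereBoundary D, f w ∂μ : ℝ) : EReal) = perron D f z

open Classical in
/-- The harmonic measure `ω_D(z, ·)`; the value `0` is used only if there is none. -/
def harmonicMeasure (D : Set ℂ) (z : ℂ) : Measure (OnePoint ℂ) :=
  if h : ∃ μ : Measure (OnePoint ℂ), IsHarmonicMeasure D z μ then h.choose else 0

open Classical in
/-- The harmonic measure `ω(z, B; ℂ ∖ S)` for the complement of a system of rays: the Dirac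
measure at the points of `S`, and the harmonic measure of the complementary angle containing `z`
at the other points. -/
def omega (S : Set ℂ) (z : ℂ) (B : Set ℂ) : ENNReal :=
  if z ∈ S then Measure.dirac z B
  else harmonicMeasure (connectedComponentIn Sᶜ z) z ((fun w : ℂ => (w : OnePoint ℂ)) '' B)

/-! ### Growth, the Blaschke condition, balayage -/

/-- The type of the positive measure `ν` at order `p` near infinity. -/
def typeAtInfty (p : ℝ) (ν : Measure ℂ) : ENNReal :=
  limsup (fun r : ℝ => ν (Metric.closedBall 0 r) / ENNReal.ofReal (r ^ p)) atTop

/-- The map `z ↦ (z e^{-iα})^{π/(β-α)}` of `∠(α, β)` onto the upper half-plane. On this angle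
`w = z e^{-iα}` has an argument in `(0, 2π)`, and `log (-w) + iπ` is the logarithm of `w` whose
imaginary part is that argument. -/
def angleReduction (α β : ℝ) (z : ℂ) : ℂ :=
  Complex.exp (((Real.pi / (β - α) : ℝ) : ℂ) *
    (Complex.log (-(z * Complex.exp (-(α : ℂ) * Complex.I))) + (Real.pi : ℂ) * Complex.I))

/-- The Blaschke condition near infinity in the angle `∠(α, β)`. -/
def BlaschkeInAngle (ν : Measure ℂ) (α β : ℝ) : Prop :=
  ∃ r₀ : ℝ, 0 < r₀ ∧
    ∫⁻ z in openAngle α β \ Metric.ball 0 r₀,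
      ENNReal.ofReal (-(1 / angleReduction α β z).im) ∂ν < ⊤

/-- The Blaschke condition near infinity outside the system of rays `S`. -/
def BlaschkeOutside (ν : Measure ℂ) (S : Set ℂ) : Prop :=
  ∀ α β : ℝ, IsComplementaryAngle S α β → BlaschkeInAngle ν α β

/-- `μ` is the balayage of `ν` onto the system of rays `S`: a Borel measure, finite on compact
sets, given by integration of the harmonic measure for the complement of `S`. -/
def IsBalayage (S : Set ℂ) (ν μ : Measure ℂ) : Prop :=
  IsFiniteMeasureOnCompacts μ ∧
    ∀ B : Set ℂ, MeasurableSet B → μ B = ∫⁻ z, omega S z B ∂ν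

end Balayage

end

open MeasureTheory Filter Topology

noncomputable section

namespace Balayage

/-! In an angle of opening β − α, put κ = π/(β − α). The conformal map w = (z e^{-iα})^κ onto the
upper half-plane turns harmonic measure into the Poisson kernel. For |z| ≥ 4r this gives two facts:
ω(z, D(r)) is comparable to r^κ · (−Im 1/w(z)), which is the integrand of the Blaschke condition,
and it is at most a constant times (r/|z|)^κ.

The lower bound (`le_angleMeasure_ball`) gives (i) ⇒ (iii). The implication (iii) ⇒ (ii) is a
restriction to fewer angles, and (iv) ⇒ (i) holds because a locally finite measure charges D(1)
finitely.

The substance is (ii) ⇒ (iv), through the estimate ∫ ω(z, closed disc of radius r) dν = O(r^p) of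
`exists_bound_lintegral_balayageKernel`. Points with |z| ≤ 4r contribute at most ν of a disc. Wide
angles, those with κ ≤ p, are finitely many, and each contributes r^κ ≤ r^p times its Blaschke
integral. In the other angles κ > p, but a uniform gap is needed. Only finitely many angles have κ ≤
p + 1, so κ ≥ q there for a single q > p (`exists_exponent_gap`), and ∫_{|z|>r} (r/|z|)^q dν =
O(r^p) by dyadic summation (`exists_bound_lintegral_tail`). The count of wide angles follows from
disjointness: the openings add up to at most 2π.

Since harmonic measure is defined by Perron functions on the sphere, the explicit formula must first
be justified. The transported Poisson integral has the mean value property and the right boundary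
limits, including at the vertex and at ∞, so the maximum principle identifies it with the Perron
function (`isHarmonicMeasure_angle`). Finite measures on the metrizable sphere are determined by
their integrals of continuous functions, whence uniqueness. -/

/-! ### The maximum principle and solutions of the Dirichlet problem -/

/-- The filter of neighbourhoods in `D` of a point of the Riemann sphere. -/
abbrev nhdsIn (D : Set ℂ) (ζ : OnePoint ℂ) : Filter ℂ :=
  comap (fun z : ℂ => (z : OnePoint ℂ)) (𝓝 ζ) ⊓ 𝓟 D

theorem mem_sphereBoundary_of_mem_closure {D : Set ℂ} {ζ : OnePoint ℂ}
    (hζ : ζ ∈ closure ((fun z : ℂ => (z : OnePoint ℂ)) '' D))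
    (hn : ζ ∉ (fun z : ℂ => (z : OnePoint ℂ)) '' D) : ζ ∈ sphereBoundary D := by
  exact ⟨hζ, fun h => hn (interior_subset h)⟩

/-- An ultrafilter on the superlevel set converges in the compact sphere. Its limit cannot be a
boundary point, where v < c nearby. So it lies in D, and semicontinuity keeps it in the set.
Unbounded D is covered because ∞ counts as a boundary point. -/
theorem isCompact_superlevel {D : Set ℂ} {v : ℂ → EReal}
    (hv : UpperSemicontinuousOn v D) {c : EReal}
    (hb : ∀ ζ ∈ sphereBoundary D, ∀ᶠ z in nhdsIn D ζ, v z < c) :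
    IsCompact {z | z ∈ D ∧ c ≤ v z} := by
  rw [isCompact_iff_ultrafilter_le_nhds]
  intro 𝒰 h𝒰
  have hKev : ∀ᶠ z in (𝒰 : Filter ℂ), z ∈ D ∧ c ≤ v z := h𝒰 (mem_principal_self _)
  have hDev : (𝒰 : Filter ℂ) ≤ 𝓟 D := le_principal_iff.2 (hKev.mono fun z h => h.1)
  set 𝒱 : Ultrafilter (OnePoint ℂ) := 𝒰.map (fun z : ℂ => (z : OnePoint ℂ))
  obtain ⟨ζ, -, hζ⟩ := isCompact_iff_ultrafilter_le_nhds.1 (isCompact_univ (X := OnePoint ℂ)) 𝒱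
    (by simp)
  have hcm : (𝒰 : Filter ℂ) ≤ nhdsIn D ζ := le_inf (map_le_iff_le_comap.1 hζ) hDev
  have hcl : ζ ∈ closure ((fun z : ℂ => (z : OnePoint ℂ)) '' D) := by
    refine mem_closure_iff_ultrafilter.2 ⟨𝒱, ?_, hζ⟩
    exact Filter.mem_map.2 (hKev.mono fun z h => ⟨z, h.1, rfl⟩)
  by_cases hn : ζ ∈ (fun z : ℂ => (z : OnePoint ℂ)) '' D
  · obtain ⟨x, hx, rfl⟩ := hn
    have h𝒰x : (𝒰 : Filter ℂ) ≤ 𝓝[D] x := by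
      rw [nhdsIn, ← OnePoint.isOpenEmbedding_coe.isInducing.nhds_eq_comap] at hcm
      exact hcm
    refine ⟨x, ⟨hx, ?_⟩, h𝒰x.trans inf_le_left⟩
    by_contra! hlt
    obtain ⟨z, hz, hz'⟩ := (hKev.and (h𝒰x (hv x hx c hlt))).exists
    exact absurd hz.2 (not_le.2 hz')
  · obtain ⟨z, hz, hz'⟩ :=
      (hKev.and (hcm (hb ζ (mem_sphereBoundary_of_mem_closure hcl hn)))).exists
    exact absurd hz.2 (not_le.2 hz')

/-- The difference u − F is kept as u plus a real number, so that the value −∞ of u causes no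
ambiguity in `EReal`. -/
theorem add_neg_coe_lt_iff {x : EReal} {a b : ℝ} :
    x + ((-a : ℝ) : EReal) < (b : EReal) ↔ x < ((a + b : ℝ) : EReal) := by
  induction x with
  | bot => simp [EReal.bot_lt_coe]
  | top => simp
  | coe x => norm_cast; constructor <;> intro h <;> linarith

theorem add_neg_coe_le_iff {x : EReal} {a b : ℝ} :
    x + ((-a : ℝ) : EReal) ≤ (b : EReal) ↔ x ≤ ((a + b : ℝ) : EReal) := by
  induction x with
  | bot => simp
  | top => rw [EReal.top_add_coe]; simp only [top_le_iff, EReal.coe_ne_top]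
  | coe x => norm_cast; constructor <;> intro h <;> linarith

theorem upperSemicontinuousOn_sub {D : Set ℂ} {u : ℂ → EReal} {F : ℂ → ℝ}
    (hu : UpperSemicontinuousOn u D) (hF : ContinuousOn F D) :
    UpperSemicontinuousOn (fun z => u z + ((-F z : ℝ) : EReal)) D := by
  intro x hx y hy
  obtain ⟨a, ha, hay⟩ := EReal.lt_iff_exists_real_btwn.1 hy
  rw [add_neg_coe_lt_iff] at ha
  obtain ⟨b, hb, hba⟩ := EReal.lt_iff_exists_real_btwn.1 ha
  have hba' : b < F x + a := by exact_mod_cast hba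
  filter_upwards [hu x hx b hb, ((hF x hx).add_const a).eventually_const_lt hba'] with z h1 h2
  refine lt_trans (add_neg_coe_lt_iff.2 (h1.trans ?_)) hay
  exact_mod_cast h2

/-- Submean inequalities are tested on continuous majorants only. Strict inequality near one point
of the circle is exploited by subtracting a multiple of this bump from a majorant. -/
theorem circleAverage_bump_pos (z : ℂ) (r η : ℝ) :
    0 < Real.circleAverage (fun w => max 0 (1 - ‖w - (z + r)‖ / η)) z r := by
  rw [Real.circleAverage]
  refine smul_pos (by positivity) ?_
  refine intervalIntegral.integral_pos (by positivity) ?_ (fun _ _ => le_max_left _ _)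
    ⟨0, ⟨le_rfl, by positivity⟩, ?_⟩
  · fun_prop
  · simp [circleMap]

/-- The maximum principle, against a continuous function with the mean value property. -/
theorem le_of_boundary_le {D : Set ℂ} {F : ℂ → ℝ} (hF : ContinuousOn F D)
    (hmv : ∀ z r, 0 < r → Metric.closedBall z r ⊆ D → Real.circleAverage F z r = F z)
    {u : ℂ → EReal} (hu : IsSubharmonicOn u D)
    (hb : ∀ c : ℝ, 0 < c → ∀ ζ ∈ sphereBoundary D, ∀ᶠ z in nhdsIn D ζ,
      u z + ((-F z : ℝ) : EReal) < (c : EReal)) {z : ℂ} (hz : z ∈ D) : u z ≤ (F z : EReal) := by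
  by_contra! hlt
  set v : ℂ → EReal := fun z => u z + ((-F z : ℝ) : EReal) with hvdef
  have hv : UpperSemicontinuousOn v D := upperSemicontinuousOn_sub hu.1 hF
  have hvz : (0 : EReal) < v z := by
    by_contra! h
    have := add_neg_coe_le_iff.1 (by simpa [hvdef] using h : u z + ((-F z : ℝ) : EReal) ≤ (0 : ℝ))
    rw [add_zero] at this
    exact absurd hlt (not_lt.2 this)
  obtain ⟨c, hc0, hcz⟩ := EReal.lt_iff_exists_real_btwn.1 hvz
  have hc : 0 < c := by exact_mod_cast hc0
  have hK : ∀ c : ℝ, 0 < c → IsCompact {z | z ∈ D ∧ (c : EReal) ≤ v z} := fun c hc =>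
    isCompact_superlevel hv (hb c hc)
  obtain ⟨m, hm, hmax⟩ := UpperSemicontinuousOn.exists_isMaxOn
    (⟨z, hz, hcz.le⟩ : {z | z ∈ D ∧ (c : EReal) ≤ v z}.Nonempty) (hK c hc)
    (hv.mono fun z h => h.1)
  have hvtop : v m < ⊤ := by
    have := hu.2.1 m hm.1
    exact EReal.add_lt_top this.ne (EReal.coe_ne_top _)
  obtain ⟨A, hA⟩ : ∃ A : ℝ, v m = A :=
    ⟨(v m).toReal, (EReal.coe_toReal hvtop.ne (fun h => by
      have := hm.2; rw [h] at this; simp at this)).symm⟩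
  have hcA : c ≤ A := by have := hm.2; rw [hA] at this; exact_mod_cast this
  have hle : ∀ w ∈ D, v w ≤ A := by
    intro w hw
    by_cases hcw : (c : EReal) ≤ v w
    · exact hA ▸ hmax ⟨hw, hcw⟩
    · exact (not_le.1 hcw).le.trans (by exact_mod_cast hcA)
  -- Among the points where v attains its maximum A, take one with largest real part. The point x +
  -- r of a small circle then has v < A, and no connectedness of D is needed.
  obtain ⟨x, hx, hxmax⟩ := (hK A (hc.trans_le hcA)).exists_isMaxOn
    ⟨m, hm.1, hA.ge⟩ Complex.continuous_re.continuousOn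
  obtain ⟨ρ, hρ, hρD, hsub⟩ := hu.2.2 x hx.1
  set r := ρ / 2 with hr
  have hr0 : 0 < r := by positivity
  have hcb : Metric.closedBall x r ⊆ D :=
    (Metric.closedBall_subset_ball (by rw [hr]; linarith)).trans hρD
  have hsph : Metric.sphere x r ⊆ D := Metric.sphere_subset_closedBall.trans hcb
  set w₀ : ℂ := x + r with hw₀
  have hw₀D : w₀ ∈ D := hsph (by simp [hw₀, abs_of_pos hr0])
  have hw₀A : v w₀ < A := by
    by_contra! h
    have h2 : w₀.re ≤ x.re := hxmax ⟨hw₀D, h⟩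
    simp [hw₀] at h2
    linarith
  obtain ⟨a, ha, haA⟩ := EReal.lt_iff_exists_real_btwn.1 hw₀A
  have haA : a < A := by exact_mod_cast haA
  obtain ⟨η, hη, hball⟩ := Metric.mem_nhdsWithin_iff.1 (hv w₀ hw₀D a ha)
  set β : ℂ → ℝ := fun w => max 0 (1 - ‖w - (x + r)‖ / η) with hβ
  have hβc : Continuous β := by rw [hβ]; fun_prop
  have hFs : ContinuousOn F (Metric.sphere x r) := hF.mono hsph
  have hFi : CircleIntegrable F x r := by
    apply ContinuousOn.circleIntegrable hr0.le hFs
  -- This function majorizes u: near w₀ one has v < a and β ≤ 1, and elsewhere β = 0 and v ≤ A. Its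
  -- mean is strictly below F x + A, contradicting v x ≥ A.
  have key := hsub r hr0 (by rw [hr]; linarith) (fun w => (F w + A) - (A - a) * β w)
    (by fun_prop) (fun w hw => by
      have h1 := hle w (hsph hw)
      by_cases hwb : w ∈ Metric.ball w₀ η
      · have h2 : v w < a := hball ⟨hwb, hsph hw⟩
        refine (add_neg_coe_lt_iff.1 h2).le.trans ?_
        have : β w ≤ 1 := by
          rw [hβ]; simp only [max_le_iff]; constructor
          · norm_num
          · linarith [div_nonneg (norm_nonneg (w - (x + r))) hη.le]
        have : F w + a ≤ F w + A - (A - a) * β w := by nlinarith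
        exact_mod_cast this
      · have : β w = 0 := by
          rw [hβ]
          simp only [max_eq_left_iff, tsub_le_iff_right, zero_add]
          rw [one_le_div hη]
          simpa [Metric.mem_ball, dist_eq_norm] using hwb
        refine (add_neg_coe_le_iff.1 h1).trans ?_
        rw [this]; simp)
  have havg : Real.circleAverage (fun w => (F w + A) - (A - a) * β w) x r
      = F x + A - (A - a) * Real.circleAverage β x r := by
    have hβi : CircleIntegrable β x r := ContinuousOn.circleIntegrable hr0.le hβc.continuousOn
    have e1 : (fun w => (F w + A) - (A - a) * β w) = (F + fun _ => A) - (A - a) • β := by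
      ext w; simp
    rw [e1, Real.circleAverage_sub (hFi.add (circleIntegrable_const _ _ _)) (hβi.const_smul),
      Real.circleAverage_add hFi (circleIntegrable_const _ _ _), Real.circleAverage_const,
      Real.circleAverage_smul, hmv x r hr0 hcb]
    rfl
  have hpos : 0 < Real.circleAverage β x r := circleAverage_bump_pos x r η
  rw [havg] at key
  have : ((A : ℝ) : EReal) ≤ ((A - (A - a) * Real.circleAverage β x r : ℝ) : EReal) := by
    refine hx.2.trans (add_neg_coe_le_iff.2 (key.trans ?_))
    exact_mod_cast (by linarith : F x + A - (A - a) * Real.circleAverage β x r ≤ _)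
  have : A ≤ A - (A - a) * Real.circleAverage β x r := by exact_mod_cast this
  nlinarith

theorem isSubharmonicOn_of_meanValue {D : Set ℂ} (hD : IsOpen D) {F : ℂ → ℝ}
    (hF : ContinuousOn F D)
    (hmv : ∀ z r, 0 < r → Metric.closedBall z r ⊆ D → Real.circleAverage F z r = F z) :
    IsSubharmonicOn (fun z => (F z : EReal)) D := by
  refine ⟨?_, fun z _ => EReal.coe_lt_top _, fun z hz => ?_⟩
  · exact (continuous_coe_real_ereal.comp_continuousOn hF).upperSemicontinuousOn
  · obtain ⟨ρ, hρ, hρD⟩ := Metric.isOpen_iff.1 hD z hz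
    refine ⟨ρ, hρ, hρD, fun r hr hrρ φ hφ hle => ?_⟩
    have hcb : Metric.closedBall z r ⊆ D := (Metric.closedBall_subset_ball hrρ).trans hρD
    change (F z : EReal) ≤ _
    rw [← hmv z r hr hcb]
    refine EReal.coe_le_coe_iff.2 (Real.circleAverage_mono ?_ ?_ ?_)
    · exact ContinuousOn.circleIntegrable hr.le
        (hF.mono (Metric.sphere_subset_closedBall.trans hcb))
    · exact ContinuousOn.circleIntegrable hr.le hφ
    · intro w hw
      rw [abs_of_pos hr] at hw
      exact EReal.coe_le_coe_iff.1 (hle w hw)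

/-- F itself belongs to the Perron family, and the maximum principle places every member of the
family below F. -/
theorem perron_eq_of_meanValue {D : Set ℂ} (hD : IsOpen D) {F : ℂ → ℝ} {f : OnePoint ℂ → ℝ}
    (hF : ContinuousOn F D)
    (hmv : ∀ z r, 0 < r → Metric.closedBall z r ⊆ D → Real.circleAverage F z r = F z)
    (hb : ∀ ζ ∈ sphereBoundary D, Tendsto F (nhdsIn D ζ) (𝓝 (f ζ))) {z : ℂ} (hz : z ∈ D) :
    perron D f z = (F z : EReal) := by
  refine le_antisymm (sSup_le ?_) (le_sSup ?_)
  · rintro y ⟨u, hu, hub, rfl⟩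
    refine le_of_boundary_le hF hmv hu (fun c hc ζ hζ => ?_) hz
    have h1 : limsup u (nhdsIn D ζ) < ((f ζ + c / 2 : ℝ) : EReal) :=
      (hub ζ hζ).trans_lt (by exact_mod_cast (by linarith : f ζ < f ζ + c / 2))
    filter_upwards [eventually_lt_of_limsup_lt h1,
      (hb ζ hζ).eventually_const_lt (by linarith : f ζ - c / 2 < f ζ)] with w hw1 hw2
    refine add_neg_coe_lt_iff.2 (hw1.trans ?_)
    exact_mod_cast (by linarith : f ζ + c / 2 < F w + c)
  · refine ⟨fun z => (F z : EReal), isSubharmonicOn_of_meanValue hD hF hmv, fun ζ hζ => ?_, rfl⟩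
    by_cases hne : (nhdsIn D ζ).NeBot
    · exact ((continuous_coe_real_ereal.tendsto _).comp (hb ζ hζ)).limsup_eq.le
    · rw [not_neBot] at hne
      change limsup _ (nhdsIn D ζ) ≤ _
      rw [hne]; simp

/-! ### The Poisson kernel of the upper half-plane -/

/-- The Poisson kernel of the upper half-plane. -/
def halfPlaneKernel (w : ℂ) (s : ℝ) : ℝ := Real.pi⁻¹ * (w.im / ((s - w.re) ^ 2 + w.im ^ 2))

/-- Harmonic measure of the upper half-plane at `w`, on the real line. -/
def halfPlaneMeasure (w : ℂ) : Measure ℝ :=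
  volume.withDensity fun s => ENNReal.ofReal (halfPlaneKernel w s)

/-- The Poisson integral of `h`, written so that it makes sense on the closed half-plane. -/
def poissonIntegral (h : ℝ → ℝ) (w : ℂ) : ℝ :=
  ∫ t, Real.pi⁻¹ * (1 + t ^ 2)⁻¹ * h (w.im * t + w.re)

theorem halfPlaneKernel_nonneg {w : ℂ} (hw : 0 ≤ w.im) (s : ℝ) : 0 ≤ halfPlaneKernel w s := by
  unfold halfPlaneKernel; positivity

theorem measurable_halfPlaneKernel :
    Measurable fun q : ℂ × ℝ => halfPlaneKernel q.1 q.2 := by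
  unfold halfPlaneKernel; fun_prop

theorem measurable_halfPlaneKernel_right (w : ℂ) : Measurable (halfPlaneKernel w) :=
  measurable_halfPlaneKernel.comp measurable_prodMk_left

theorem halfPlaneKernel_eq_cauchyPDFReal {w : ℂ} (hw : 0 ≤ w.im) :
    halfPlaneKernel w = ProbabilityTheory.cauchyPDFReal w.re w.im.toNNReal := by
  ext s
  rw [halfPlaneKernel, ProbabilityTheory.cauchyPDFReal_def, div_eq_mul_inv, mul_assoc,
    Real.coe_toNNReal _ hw]

theorem integrable_halfPlaneKernel {w : ℂ} (hw : 0 ≤ w.im) : Integrable (halfPlaneKernel w) := by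
  rw [halfPlaneKernel_eq_cauchyPDFReal hw]
  exact ProbabilityTheory.integrable_cauchyPDFReal _

theorem integral_halfPlaneKernel {w : ℂ} (hw : 0 < w.im) : ∫ s, halfPlaneKernel w s = 1 := by
  rw [halfPlaneKernel_eq_cauchyPDFReal hw.le]
  exact ProbabilityTheory.integral_cauchyPDFReal_eq_one _ (Real.toNNReal_pos.2 hw).ne'

theorem isProbabilityMeasure_halfPlaneMeasure {w : ℂ} (hw : 0 < w.im) :
    IsProbabilityMeasure (halfPlaneMeasure w) := by
  constructor
  rw [halfPlaneMeasure, withDensity_apply _ MeasurableSet.univ, setLIntegral_univ,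
    ← ofReal_integral_eq_lintegral_ofReal (integrable_halfPlaneKernel hw.le)
      (ae_of_all _ (halfPlaneKernel_nonneg hw.le)), integral_halfPlaneKernel hw,
    ENNReal.ofReal_one]

theorem integral_halfPlaneMeasure {w : ℂ} (hw : 0 ≤ w.im) (h : ℝ → ℝ) :
    ∫ s, h s ∂halfPlaneMeasure w = ∫ s, halfPlaneKernel w s * h s := by
  rw [halfPlaneMeasure, integral_withDensity_eq_integral_toReal_smul
    (measurable_halfPlaneKernel_right w).ennreal_ofReal (ae_of_all _ fun _ => ENNReal.ofReal_lt_top)]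
  refine integral_congr_ae (ae_of_all _ fun s => ?_)
  simp only [smul_eq_mul, ENNReal.toReal_ofReal (halfPlaneKernel_nonneg hw s)]

theorem poissonIntegral_eq {w : ℂ} (hw : 0 < w.im) (h : ℝ → ℝ) :
    poissonIntegral h w = ∫ s, h s ∂halfPlaneMeasure w := by
  rw [integral_halfPlaneMeasure hw.le,
    ← integral_add_right_eq_self (fun s => halfPlaneKernel w s * h s) w.re]
  have := Measure.integral_comp_mul_left
    (fun s => halfPlaneKernel w (s + w.re) * h (s + w.re)) w.im
  rw [abs_of_pos (inv_pos.2 hw), smul_eq_mul] at this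
  rw [← mul_right_inj' (inv_pos.2 hw).ne', ← this, poissonIntegral, ← integral_const_mul]
  refine integral_congr_ae (ae_of_all _ fun t => ?_)
  simp only [halfPlaneKernel, add_sub_cancel_right]
  rw [← mul_assoc]
  congr 1
  have : 1 + t ^ 2 ≠ 0 := by positivity
  have : (w.im * t) ^ 2 + w.im ^ 2 = w.im ^ 2 * (1 + t ^ 2) := by ring
  rw [this]
  field_simp

/-- The substitution s = Re w + t Im w leaves a fixed integrable density in t. Dominated convergence
then gives continuity up to the real line, with no approximate identity argument. -/
theorem continuous_poissonIntegral {h : ℝ → ℝ} (hc : Continuous h) {M : ℝ}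
    (hM : ∀ s, |h s| ≤ M) : Continuous (poissonIntegral h) := by
  refine continuous_of_dominated (bound := fun t => Real.pi⁻¹ * (1 + t ^ 2)⁻¹ * M)
    (fun w => ?_) (fun w => ae_of_all _ fun t => ?_) ?_ (ae_of_all _ fun t => ?_)
  · exact Measurable.aestronglyMeasurable (by fun_prop)
  · rw [norm_mul, Real.norm_of_nonneg (by positivity : 0 ≤ Real.pi⁻¹ * (1 + t ^ 2)⁻¹)]
    exact mul_le_mul_of_nonneg_left (hM _) (by positivity)
  · exact (integrable_inv_one_add_sq.const_mul _).mul_const _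
  · fun_prop

theorem poissonIntegral_ofReal (h : ℝ → ℝ) (s : ℝ) : poissonIntegral h s = h s := by
  simp only [poissonIntegral, Complex.ofReal_im, Complex.ofReal_re, zero_mul, zero_add]
  rw [integral_mul_const, integral_const_mul, integral_univ_inv_one_add_sq,
    inv_mul_cancel₀ Real.pi_ne_zero, one_mul]

/-! ### Comparison of the Poisson kernel with the Blaschke weight −Im(1/w) -/

theorem neg_one_div_im (w : ℂ) : -(1 / w).im = w.im / ‖w‖ ^ 2 := by
  rw [one_div, Complex.inv_im, Complex.normSq_eq_norm_sq, neg_div, neg_neg]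

theorem norm_sub_sq_eq (w : ℂ) (s : ℝ) : (s - w.re) ^ 2 + w.im ^ 2 = ‖(s : ℂ) - w‖ ^ 2 := by
  rw [← Complex.normSq_eq_norm_sq, Complex.normSq_apply]
  simp
  ring

/-- Here |s − w| ≥ |w|/2, while −Im(1/w) = Im w / |w|². With the reverse bound from |s − w| ≤ 2|w|,
the harmonic measure of a bounded interval is comparable to its length times the Blaschke weight. -/
theorem halfPlaneKernel_le {w : ℂ} (hw : 0 < w.im) {s R : ℝ} (hs : |s| ≤ R)
    (hR : 2 * R ≤ ‖w‖) : halfPlaneKernel w s ≤ 4 / Real.pi * -(1 / w).im := by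
  have hw0 : 0 < ‖w‖ := norm_pos_iff.2 (by rintro rfl; simp at hw)
  have h1 : ‖w‖ / 2 ≤ ‖(s : ℂ) - w‖ := by
    have := norm_sub_norm_le w (s : ℂ)
    rw [norm_sub_rev, Complex.norm_real, Real.norm_eq_abs] at this
    linarith
  rw [neg_one_div_im, halfPlaneKernel, norm_sub_sq_eq]
  have h2 : w.im / ‖(s : ℂ) - w‖ ^ 2 ≤ w.im / (‖w‖ / 2) ^ 2 := by gcongr
  calc Real.pi⁻¹ * (w.im / ‖(s : ℂ) - w‖ ^ 2) ≤ Real.pi⁻¹ * (w.im / (‖w‖ / 2) ^ 2) := by gcongr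
    _ = _ := by field_simp; norm_num

theorem le_halfPlaneKernel {w : ℂ} (hw : 0 < w.im) {s R : ℝ} (hs : |s| ≤ R)
    (hR : R ≤ ‖w‖) : 1 / (4 * Real.pi) * -(1 / w).im ≤ halfPlaneKernel w s := by
  have hw0 : 0 < ‖w‖ := norm_pos_iff.2 (by rintro rfl; simp at hw)
  have h1 : ‖(s : ℂ) - w‖ ≤ 2 * ‖w‖ := by
    have := norm_sub_le (s : ℂ) w
    rw [Complex.norm_real, Real.norm_eq_abs] at this
    linarith
  have h3 : 0 < ‖(s : ℂ) - w‖ := by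
    refine norm_pos_iff.2 fun h => ?_
    have := congrArg Complex.im h
    simp at this
    exact hw.ne' this
  rw [neg_one_div_im, halfPlaneKernel, norm_sub_sq_eq]
  have h2 : w.im / (2 * ‖w‖) ^ 2 ≤ w.im / ‖(s : ℂ) - w‖ ^ 2 := by gcongr
  calc _ = Real.pi⁻¹ * (w.im / (2 * ‖w‖) ^ 2) := by field_simp; norm_num
    _ ≤ _ := by gcongr

theorem halfPlaneMeasure_Icc_le {w : ℂ} (hw : 0 < w.im) {R : ℝ} (hR0 : 0 ≤ R)
    (hR : 2 * R ≤ ‖w‖) :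
    halfPlaneMeasure w (Set.Icc (-R) R) ≤ ENNReal.ofReal (8 / Real.pi * R * -(1 / w).im) := by
  rw [halfPlaneMeasure, withDensity_apply _ measurableSet_Icc]
  calc _ ≤ ∫⁻ _ in Set.Icc (-R) R, ENNReal.ofReal (4 / Real.pi * -(1 / w).im) :=
        setLIntegral_mono measurable_const fun s hs =>
          ENNReal.ofReal_le_ofReal (halfPlaneKernel_le hw (abs_le.2 hs) hR)
    _ = _ := by
        rw [setLIntegral_const, Real.volume_Icc, ← ENNReal.ofReal_mul' (by linarith)]
        congr 1; ring

theorem le_halfPlaneMeasure_Ioo {w : ℂ} (hw : 0 < w.im) {R : ℝ} (hR0 : 0 ≤ R)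
    (hR : R ≤ ‖w‖) :
    ENNReal.ofReal (R / (2 * Real.pi) * -(1 / w).im) ≤ halfPlaneMeasure w (Set.Ioo (-R) R) := by
  rw [halfPlaneMeasure, withDensity_apply _ measurableSet_Ioo]
  calc _ = ∫⁻ _ in Set.Ioo (-R) R, ENNReal.ofReal (1 / (4 * Real.pi) * -(1 / w).im) := by
        rw [setLIntegral_const, Real.volume_Ioo, ← ENNReal.ofReal_mul' (by linarith)]
        congr 1; field_simp; ring
    _ ≤ _ := setLIntegral_mono (measurable_halfPlaneKernel_right w).ennreal_ofReal fun s hs =>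
          ENNReal.ofReal_le_ofReal (le_halfPlaneKernel hw (abs_lt.2 hs).le hR)

/-- The mass given to a fixed interval [−R, R] is O(1/|w|), so in the limit only values of h near a
count. This supplies the boundary value at ∞. -/
theorem tendsto_poissonIntegral_infty {h : ℝ → ℝ} (hc : Continuous h) {M : ℝ}
    (hM : ∀ s, |h s| ≤ M) {a : ℝ} (ha : Tendsto h (cocompact ℝ) (𝓝 a)) :
    Tendsto (poissonIntegral h) (cocompact ℂ ⊓ 𝓟 {w | 0 < w.im}) (𝓝 a) := by
  have hM0 : 0 ≤ M := (abs_nonneg _).trans (hM 0)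
  rw [Metric.tendsto_nhds]
  intro ε hε
  have h1 : {s | |h s - a| < ε / 2} ∈ Bornology.cobounded ℝ := by
    rw [Metric.cobounded_eq_cocompact]
    simpa [Real.dist_eq] using (Metric.tendsto_nhds.1 ha) (ε / 2) (by positivity)
  obtain ⟨R₁, -, hR₁⟩ := (Metric.hasBasis_cobounded_compl_closedBall (0 : ℝ)).mem_iff.1 h1
  set R := max R₁ 0
  have hR0 : 0 ≤ R := le_max_right _ _
  have hR : ∀ s, s ∉ Set.Icc (-R) R → |h s - a| < ε / 2 := fun s hs => hR₁ fun h => hs <| by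
    rw [mem_closedBall_zero_iff, Real.norm_eq_abs] at h
    exact abs_le.1 (h.trans (le_max_left _ _))
  set A := M + |a| with hA
  have hA0 : 0 ≤ A := by positivity
  have hlim : Tendsto (fun w : ℂ => A * (8 / Real.pi * R) / ‖w‖) (cocompact ℂ) (𝓝 0) :=
    (tendsto_norm_cocompact_atTop (E := ℂ)).const_div_atTop _
  rw [eventually_inf_principal]
  filter_upwards [hlim.eventually_lt_const (by positivity : (0 : ℝ) < ε / 2),
    (tendsto_norm_cocompact_atTop (E := ℂ)).eventually_ge_atTop (2 * R)] with w hw1 hw2 hw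
  have hw : 0 < w.im := hw
  have hw0 : 0 < ‖w‖ := norm_pos_iff.2 (by rintro rfl; simp at hw)
  have := isProbabilityMeasure_halfPlaneMeasure hw
  have hintegr : Integrable h (halfPlaneMeasure w) :=
    Integrable.of_bound hc.aestronglyMeasurable M (ae_of_all _ hM)
  have hPR : (halfPlaneMeasure w).real (Set.Icc (-R) R) ≤ 8 / Real.pi * R / ‖w‖ := by
    refine ENNReal.toReal_le_of_le_ofReal (by positivity)
      ((halfPlaneMeasure_Icc_le hw hR0 hw2).trans (ENNReal.ofReal_le_ofReal ?_))
    rw [neg_one_div_im]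
    have : w.im / ‖w‖ ^ 2 ≤ 1 / ‖w‖ := by
      rw [div_le_div_iff₀ (by positivity) hw0]
      nlinarith [Complex.im_le_norm w]
    calc _ ≤ 8 / Real.pi * R * (1 / ‖w‖) := by gcongr
      _ = _ := by ring
  have hsub : poissonIntegral h w - a = ∫ s, (h s - a) ∂halfPlaneMeasure w := by
    rw [integral_sub hintegr (integrable_const _), poissonIntegral_eq hw]
    simp
  have hbd : ∀ s, ‖h s - a‖ ≤ ε / 2 + (Set.Icc (-R) R).indicator (fun _ => A) s := by
    intro s
    by_cases hs : s ∈ Set.Icc (-R) R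
    · rw [Set.indicator_of_mem hs]
      have := (abs_sub (h s) a)
      rw [Real.norm_eq_abs]
      linarith [hM s]
    · rw [Set.indicator_of_notMem hs, add_zero]
      exact (hR s hs).le
  rw [Real.dist_eq, hsub, ← Real.norm_eq_abs]
  calc _ ≤ ∫ s, (ε / 2 + (Set.Icc (-R) R).indicator (fun _ => A) s) ∂halfPlaneMeasure w :=
        norm_integral_le_of_norm_le
          ((integrable_const _).add ((integrable_const A).indicator measurableSet_Icc))
          (ae_of_all _ hbd)
    _ = ε / 2 + (halfPlaneMeasure w).real (Set.Icc (-R) R) * A := by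
        rw [integral_add (integrable_const _) ((integrable_const A).indicator measurableSet_Icc),
          integral_indicator measurableSet_Icc]
        simp
    _ ≤ ε / 2 + 8 / Real.pi * R / ‖w‖ * A := by gcongr
    _ < ε := by
        have : 8 / Real.pi * R / ‖w‖ * A = A * (8 / Real.pi * R) / ‖w‖ := by ring
        linarith

/-! ### Mean value property of Poisson integrals composed with holomorphic maps -/

theorem halfPlaneKernel_eq_im (w : ℂ) (s : ℝ) :
    halfPlaneKernel w s = Real.pi⁻¹ * (1 / ((s : ℂ) - w)).im := by
  rw [halfPlaneKernel, norm_sub_sq_eq, ← neg_neg (1 / ((s : ℂ) - w)).im, neg_one_div_im]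
  simp [neg_div]

/-- The kernel is the imaginary part of the holomorphic function 1/(s − W), up to the factor 1/π,
and holomorphic functions have the mean value property. -/
theorem circleAverage_halfPlaneKernel {D : Set ℂ} {W : ℂ → ℂ}
    (hW : DifferentiableOn ℂ W D) (hWim : ∀ z ∈ D, 0 < (W z).im) {z : ℂ} {r : ℝ} (hr : 0 < r)
    (hzr : Metric.closedBall z r ⊆ D) (s : ℝ) :
    Real.circleAverage (fun z => halfPlaneKernel (W z) s) z r = halfPlaneKernel (W z) s := by
  have hd : DifferentiableOn ℂ (fun z => 1 / ((s : ℂ) - W z)) D := by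
    refine DifferentiableOn.div (by fun_prop) (by fun_prop) fun z hz h => ?_
    have := congrArg Complex.im h
    simp at this
    exact (hWim z hz).ne' this
  have hdc := hd.diffContOnCl_ball hzr
  rw [← abs_of_pos hr] at hdc
  have h1 := hdc.circleAverage
  have hci : CircleIntegrable (fun z => 1 / ((s : ℂ) - W z)) z r :=
    ContinuousOn.circleIntegrable hr.le
      (hd.continuousOn.mono (Metric.sphere_subset_closedBall.trans hzr))
  have h2 := Complex.imCLM.circleAverage_comp_comm hci
  have e : (fun z => halfPlaneKernel (W z) s)
      = Real.pi⁻¹ • (Complex.imCLM ∘ fun z => 1 / ((s : ℂ) - W z)) := by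
    ext z
    simp [halfPlaneKernel_eq_im]
  rw [e, Real.circleAverage_smul, h2, h1, halfPlaneKernel_eq_im]
  rfl

theorem circleAverage_poissonIntegral {D : Set ℂ} {W : ℂ → ℂ}
    (hW : DifferentiableOn ℂ W D) (hWim : ∀ z ∈ D, 0 < (W z).im) {z : ℂ} {r : ℝ} (hr : 0 < r)
    (hzr : Metric.closedBall z r ⊆ D) {h : ℝ → ℝ} (hc : Continuous h) {M : ℝ}
    (hM : ∀ s, |h s| ≤ M) :
    Real.circleAverage (fun z => poissonIntegral h (W z)) z r = poissonIntegral h (W z) := by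
  have hmem : ∀ θ, circleMap z r θ ∈ D := fun θ =>
    hzr (Metric.sphere_subset_closedBall (circleMap_mem_sphere z hr.le θ))
  have him : ∀ θ, 0 < (W (circleMap z r θ)).im := fun θ => hWim _ (hmem θ)
  have hcont : Continuous fun θ => W (circleMap z r θ) :=
    hW.continuousOn.comp_continuous (continuous_circleMap z r) hmem
  have hmeas : Measurable fun q : ℝ × ℝ => halfPlaneKernel (W (circleMap z r q.1)) q.2 :=
    measurable_halfPlaneKernel.comp
      ((hcont.measurable.comp measurable_fst).prodMk measurable_snd)
  have hPi : (0 : ℝ) ≤ 2 * Real.pi := by positivity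
  -- Each kernel has total mass 1, so the double integral over the circle and the line is finite.
  -- Fubini then reduces the claim to the mean value property for each s.
  have hintegr : Integrable (fun q : ℝ × ℝ => halfPlaneKernel (W (circleMap z r q.1)) q.2)
      ((volume.restrict (Set.Ioc 0 (2 * Real.pi))).prod volume) := by
    rw [integrable_prod_iff hmeas.aestronglyMeasurable]
    refine ⟨ae_of_all _ fun θ => integrable_halfPlaneKernel (him θ).le, ?_⟩
    have : (fun θ => ∫ s, ‖halfPlaneKernel (W (circleMap z r θ)) s‖) = fun _ => (1 : ℝ) := by
      ext θ
      rw [← integral_halfPlaneKernel (him θ)]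
      exact integral_congr_ae (ae_of_all _ fun s =>
        Real.norm_of_nonneg (halfPlaneKernel_nonneg (him θ).le s))
    simp only [this]
    exact integrable_const _
  have hmulint : Integrable (Function.uncurry fun θ s : ℝ =>
      halfPlaneKernel (W (circleMap z r θ)) s * h s)
      ((volume.restrict (Set.Ioc 0 (2 * Real.pi))).prod volume) :=
    hintegr.mul_bdd (c := M) (hc.measurable.comp measurable_snd).aestronglyMeasurable
      (ae_of_all _ fun q => hM q.2)
  have hz : z ∈ D := hzr (Metric.mem_closedBall_self hr.le)
  rw [poissonIntegral_eq (hWim z hz), integral_halfPlaneMeasure (hWim z hz).le,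
    Real.circleAverage, intervalIntegral.integral_of_le hPi]
  have e1 : ∀ θ, poissonIntegral h (W (circleMap z r θ))
      = ∫ s, halfPlaneKernel (W (circleMap z r θ)) s * h s := fun θ => by
    rw [poissonIntegral_eq (him θ), integral_halfPlaneMeasure (him θ).le]
  simp only [e1]
  rw [integral_integral_swap hmulint, ← integral_smul]
  refine integral_congr_ae (ae_of_all _ fun s => ?_)
  simp only
  rw [← circleAverage_halfPlaneKernel hW hWim hr hzr s, integral_mul_const, Real.circleAverage,
    intervalIntegral.integral_of_le hPi, smul_eq_mul, smul_eq_mul, mul_assoc]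

/-! ### Angles and the upper half-plane -/

theorem eq_add_two_pi_mul_of_polar_eq {r r' θ θ' : ℝ} (hr : 0 < r) (hr' : 0 < r')
    (h : (r : ℂ) * Complex.exp (θ * Complex.I) = r' * Complex.exp (θ' * Complex.I)) :
    ∃ n : ℤ, θ = θ' + n * (2 * Real.pi) := by
  have hn := congrArg norm h
  simp only [norm_mul, Complex.norm_exp_ofReal_mul_I, mul_one, Complex.norm_real,
    Real.norm_of_nonneg hr.le, Real.norm_of_nonneg hr'.le] at hn
  subst hn
  have h2 := mul_left_cancel₀ (Complex.ofReal_ne_zero.2 hr.ne') h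
  obtain ⟨n, hn⟩ := Complex.exp_eq_exp_iff_exists_int.1 h2
  refine ⟨n, ?_⟩
  have := congrArg Complex.im hn
  simpa using this

theorem polar_notMem_openAngle_left {α β r : ℝ} (hβ : β ≤ α + 2 * Real.pi) (hr : 0 < r) :
    (r : ℂ) * Complex.exp (α * Complex.I) ∉ openAngle α β := by
  rintro ⟨r', θ, hr', h1, h2, h3⟩
  obtain ⟨n, hn⟩ := eq_add_two_pi_mul_of_polar_eq hr hr' h3
  have hpi := Real.pi_pos
  have hn0 : (n : ℝ) < 0 := by
    by_contra! hc
    nlinarith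
  have hn1 : (n : ℝ) ≤ -1 := by
    have : n < 0 := by exact_mod_cast hn0
    exact_mod_cast (by omega : n ≤ -1)
  nlinarith

theorem polar_notMem_openAngle_right {α β r : ℝ} (hβ : β ≤ α + 2 * Real.pi) (hr : 0 < r) :
    (r : ℂ) * Complex.exp (β * Complex.I) ∉ openAngle α β := by
  rintro ⟨r', θ, hr', h1, h2, h3⟩
  obtain ⟨n, hn⟩ := eq_add_two_pi_mul_of_polar_eq hr hr' h3
  have hpi := Real.pi_pos
  have hn0 : (0 : ℝ) < n := by
    by_contra! hc
    nlinarith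
  have hn1 : (1 : ℝ) ≤ n := by
    have : 0 < n := by exact_mod_cast hn0
    exact_mod_cast (by omega : 1 ≤ n)
  nlinarith

theorem zero_notMem_openAngle (α β : ℝ) : (0 : ℂ) ∉ openAngle α β := by
  rintro ⟨r, θ, hr, -, -, h⟩
  have := mul_ne_zero (Complex.ofReal_ne_zero.2 hr.ne') (Complex.exp_ne_zero (θ * Complex.I))
  exact this h.symm

theorem neg_polar_mul_exp (α r θ : ℝ) :
    -((r : ℂ) * Complex.exp (θ * Complex.I) * Complex.exp (-(α : ℂ) * Complex.I))
      = r * Complex.exp (((θ - α - Real.pi : ℝ) : ℂ) * Complex.I) := by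
  have : ((θ - α - Real.pi : ℝ) : ℂ) * Complex.I
      = (θ : ℂ) * Complex.I + -(α : ℂ) * Complex.I + -(Real.pi * Complex.I) := by
    push_cast; ring
  rw [this, Complex.exp_add, Complex.exp_add, Complex.exp_neg (Real.pi * Complex.I),
    Complex.exp_pi_mul_I]
  ring

theorem arg_polar {r θ : ℝ} (hr : 0 < r) (hθ : θ ∈ Set.Ioc (-Real.pi) Real.pi) :
    ((r : ℂ) * Complex.exp (θ * Complex.I)).arg = θ := by
  rw [Complex.exp_mul_I, Complex.arg_mul_cos_add_sin_mul_I hr hθ]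

/-- After rotation by −α and a half-turn, the side of argument α lies on the cut of the principal
argument. Openness of the angle and holomorphy of `angleReduction` are then read off from
`Complex.slitPlane`. -/
theorem mem_openAngle_iff {α β : ℝ} (hβ : β ≤ α + 2 * Real.pi) {z : ℂ} :
    z ∈ openAngle α β ↔ -(z * Complex.exp (-(α : ℂ) * Complex.I)) ∈ Complex.slitPlane ∧
      (-(z * Complex.exp (-(α : ℂ) * Complex.I))).arg ∈ Set.Iio (β - α - Real.pi) := by
  constructor
  · rintro ⟨r, θ, hr, h1, h2, rfl⟩
    have harg : (-((r : ℂ) * Complex.exp (θ * Complex.I) *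
        Complex.exp (-(α : ℂ) * Complex.I))).arg = θ - α - Real.pi := by
      rw [neg_polar_mul_exp, arg_polar hr ⟨by linarith, by linarith⟩]
    rw [Complex.mem_slitPlane_iff_arg, harg]
    refine ⟨⟨by linarith, ?_⟩, ?_⟩
    · simp [hr.ne']
    · simp only [Set.mem_Iio]; linarith
  · rintro ⟨h1, h2⟩
    set x := -(z * Complex.exp (-(α : ℂ) * Complex.I)) with hx
    rw [Complex.mem_slitPlane_iff_arg] at h1
    refine ⟨‖x‖, x.arg + Real.pi + α, norm_pos_iff.2 h1.2, ?_, ?_, ?_⟩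
    · linarith [Complex.neg_pi_lt_arg x]
    · simp only [Set.mem_Iio] at h2; linarith
    · have e := Complex.norm_mul_exp_arg_mul_I x
      have e2 : ((x.arg + Real.pi + α : ℝ) : ℂ) * Complex.I
          = x.arg * Complex.I + Real.pi * Complex.I + α * Complex.I := by push_cast; ring
      rw [e2, Complex.exp_add, Complex.exp_add, Complex.exp_pi_mul_I, ← mul_assoc, ← mul_assoc, e,
        hx, neg_mul (α : ℂ), Complex.exp_neg]
      field_simp

theorem isOpen_openAngle {α β : ℝ} (hβ : β ≤ α + 2 * Real.pi) : IsOpen (openAngle α β) := by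
  have h1 : IsOpen (Complex.slitPlane ∩ Complex.arg ⁻¹' Set.Iio (β - α - Real.pi)) :=
    ContinuousOn.isOpen_inter_preimage
      (fun x hx => (Complex.continuousAt_arg hx).continuousWithinAt) Complex.isOpen_slitPlane
      isOpen_Iio
  have h2 : Continuous fun z : ℂ => -(z * Complex.exp (-(α : ℂ) * Complex.I)) := by fun_prop
  convert h1.preimage h2 using 1
  ext z
  exact mem_openAngle_iff hβ

/-- The exponent `π / (β - α)` of the map of `∠(α, β)` onto the upper half-plane. -/
def angleExponent (α β : ℝ) : ℝ := Real.pi / (β - α)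

theorem angleExponent_pos {α β : ℝ} (h : α < β) : 0 < angleExponent α β :=
  div_pos Real.pi_pos (sub_pos.2 h)

theorem half_le_angleExponent {α β : ℝ} (h : α < β) (hβ : β ≤ α + 2 * Real.pi) :
    1 / 2 ≤ angleExponent α β := by
  rw [angleExponent, div_le_div_iff₀ (by norm_num) (sub_pos.2 h)]
  linarith

theorem angleReduction_polar {α β r θ : ℝ} (hβ : β ≤ α + 2 * Real.pi) (hr : 0 < r)
    (h1 : α < θ) (h2 : θ < β) :
    angleReduction α β (r * Complex.exp (θ * Complex.I))
      = ((r ^ angleExponent α β : ℝ) : ℂ) *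
        Complex.exp (((angleExponent α β * (θ - α) : ℝ) : ℂ) * Complex.I) := by
  rw [angleReduction, neg_polar_mul_exp, Complex.log_ofReal_mul hr (Complex.exp_ne_zero _),
    Complex.log_exp (by simp; linarith) (by simp; linarith), ← angleExponent,
    Real.rpow_def_of_pos hr, Complex.ofReal_exp, ← Complex.exp_add]
  congr 1
  push_cast
  ring

theorem angleExponent_mul_mem {α β θ : ℝ} (h1 : α < θ) (h2 : θ < β) :
    angleExponent α β * (θ - α) ∈ Set.Ioo 0 Real.pi := by
  have hαβ := h1.trans h2
  refine ⟨mul_pos (angleExponent_pos hαβ) (by linarith), ?_⟩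
  have : angleExponent α β * (β - α) = Real.pi := by
    rw [angleExponent, div_mul_cancel₀ _ (sub_pos.2 hαβ).ne']
  nlinarith [angleExponent_pos hαβ]

theorem angleReduction_im_pos {α β : ℝ} (hβ : β ≤ α + 2 * Real.pi) {z : ℂ}
    (hz : z ∈ openAngle α β) : 0 < (angleReduction α β z).im := by
  obtain ⟨r, θ, hr, h1, h2, rfl⟩ := hz
  rw [angleReduction_polar hβ hr h1 h2, Complex.im_ofReal_mul, Complex.exp_ofReal_mul_I_im]
  exact mul_pos (Real.rpow_pos_of_pos hr _)
    (Real.sin_pos_of_mem_Ioo (angleExponent_mul_mem h1 h2))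

theorem norm_angleReduction {α β : ℝ} (hβ : β ≤ α + 2 * Real.pi) {z : ℂ}
    (hz : z ∈ openAngle α β) : ‖angleReduction α β z‖ = ‖z‖ ^ angleExponent α β := by
  obtain ⟨r, θ, hr, h1, h2, rfl⟩ := hz
  rw [angleReduction_polar hβ hr h1 h2]
  simp only [norm_mul, Complex.norm_exp_ofReal_mul_I, mul_one, Complex.norm_real,
    Real.norm_of_nonneg hr.le, Real.norm_of_nonneg (Real.rpow_nonneg hr.le _)]

theorem differentiableOn_angleReduction {α β : ℝ} (hβ : β ≤ α + 2 * Real.pi) :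
    DifferentiableOn ℂ (angleReduction α β) (openAngle α β) := by
  intro z hz
  have := ((mem_openAngle_iff hβ).1 hz).1
  unfold angleReduction
  refine DifferentiableAt.differentiableWithinAt ?_
  refine DifferentiableAt.cexp (DifferentiableAt.const_mul (DifferentiableAt.add_const _ ?_) _)
  exact DifferentiableAt.clog (by fun_prop) this

/-- The inverse of `angleReduction`, extended to the closed upper half-plane. -/
def angleParam (α β : ℝ) (w : ℂ) : ℂ :=
  ((‖w‖ ^ (angleExponent α β)⁻¹ : ℝ) : ℂ) *
    Complex.exp (((α + w.arg * (angleExponent α β)⁻¹ : ℝ) : ℂ) * Complex.I)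

theorem angleParam_angleReduction {α β : ℝ} (hβ : β ≤ α + 2 * Real.pi) {z : ℂ}
    (hz : z ∈ openAngle α β) : angleParam α β (angleReduction α β z) = z := by
  have hn := norm_angleReduction hβ hz
  obtain ⟨r, θ, hr, h1, h2, rfl⟩ := hz
  have hκ := angleExponent_pos (h1.trans h2)
  have hm := angleExponent_mul_mem h1 h2
  rw [angleParam, hn, angleReduction_polar hβ hr h1 h2,
    arg_polar (Real.rpow_pos_of_pos hr _) ⟨by linarith [hm.1, Real.pi_pos], hm.2.le⟩,
    norm_mul, Complex.norm_exp_ofReal_mul_I, mul_one, Complex.norm_real,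
    Real.norm_of_nonneg hr.le, Real.rpow_rpow_inv hr.le hκ.ne']
  have : α + angleExponent α β * (θ - α) * (angleExponent α β)⁻¹ = θ := by
    field_simp; ring
  rw [this]

theorem norm_angleParam (α β : ℝ) (w : ℂ) :
    ‖angleParam α β w‖ = ‖w‖ ^ (angleExponent α β)⁻¹ := by
  rw [angleParam, norm_mul, Complex.norm_exp_ofReal_mul_I, mul_one, Complex.norm_real,
    Real.norm_of_nonneg (by positivity)]

theorem angleParam_mem {α β : ℝ} (hαβ : α < β) {w : ℂ} (hw : 0 < w.im) :
    angleParam α β w ∈ openAngle α β := by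
  have hκ := angleExponent_pos hαβ
  have hw0 : 0 < ‖w‖ := norm_pos_iff.2 (by rintro rfl; simp at hw)
  have h0 : 0 < w.arg := lt_of_le_of_ne (Complex.arg_nonneg_iff.2 hw.le)
    fun h => hw.ne' (Complex.arg_eq_zero_iff.1 h.symm).2
  have h1 : w.arg < Real.pi := Complex.arg_lt_pi_iff.2 (Or.inr hw.ne')
  refine ⟨_, _, Real.rpow_pos_of_pos hw0 _, ?_, ?_, rfl⟩
  · linarith [mul_pos h0 (inv_pos.2 hκ)]
  · have : Real.pi * (angleExponent α β)⁻¹ = β - α := by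
      rw [angleExponent, inv_div]; field_simp
    nlinarith [inv_pos.2 hκ]

/-- On the negative axis the argument takes the value π, which is its limit from above. At 0 the
argument has no limit, but the factor ‖w‖^(1/κ) tends to 0. -/
theorem continuousOn_angleParam {α β : ℝ} (hαβ : α < β) :
    ContinuousOn (angleParam α β) {w | 0 ≤ w.im} := by
  have hκ := angleExponent_pos hαβ
  intro w hw
  by_cases h0 : w = 0
  · subst h0
    have e : angleParam α β 0 = 0 := by
      rw [← norm_eq_zero, norm_angleParam, norm_zero, Real.zero_rpow (inv_pos.2 hκ).ne']
    rw [ContinuousWithinAt, e, tendsto_zero_iff_norm_tendsto_zero]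
    simp only [norm_angleParam]
    have : Continuous fun w : ℂ => ‖w‖ ^ (angleExponent α β)⁻¹ :=
      continuous_norm.rpow_const fun _ => Or.inr (inv_pos.2 hκ).le
    have h2 := (this.tendsto 0).mono_left (nhdsWithin_le_nhds (s := {w : ℂ | 0 ≤ w.im}))
    simpa [Real.zero_rpow (inv_pos.2 hκ).ne'] using h2
  · have harg : ContinuousWithinAt Complex.arg {w | 0 ≤ w.im} w := by
      by_cases hs : w ∈ Complex.slitPlane
      · exact (Complex.continuousAt_arg hs).continuousWithinAt
      · rw [Complex.mem_slitPlane_iff, not_or, not_lt, not_not] at hs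
        refine Complex.continuousWithinAt_arg_of_re_neg_of_im_zero
          (lt_of_le_of_ne hs.1 fun h => h0 (Complex.ext h hs.2)) hs.2
    have hnorm : ContinuousWithinAt (fun w : ℂ => ‖w‖ ^ (angleExponent α β)⁻¹) {w | 0 ≤ w.im} w :=
      (continuous_norm.rpow_const fun _ => Or.inr (inv_pos.2 hκ).le).continuousWithinAt
    unfold angleParam
    refine ContinuousWithinAt.mul ?_ (ContinuousWithinAt.cexp (ContinuousWithinAt.mul ?_
      continuousWithinAt_const))
    · exact Complex.continuous_ofReal.continuousAt.comp_continuousWithinAt hnorm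
    · exact Complex.continuous_ofReal.continuousAt.comp_continuousWithinAt
        (continuousWithinAt_const.add (harg.mul continuousWithinAt_const))

/-- The parametrization of the boundary of `∠(α, β)` by the real line. -/
def boundaryParam (α β : ℝ) (s : ℝ) : ℂ := angleParam α β s

theorem continuous_boundaryParam {α β : ℝ} (hαβ : α < β) : Continuous (boundaryParam α β) :=
  (continuousOn_angleParam hαβ).comp_continuous Complex.continuous_ofReal (by simp)

theorem norm_boundaryParam (α β s : ℝ) :
    ‖boundaryParam α β s‖ = |s| ^ (angleExponent α β)⁻¹ := by
  rw [boundaryParam, norm_angleParam, Complex.norm_real, Real.norm_eq_abs]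

theorem boundaryParam_notMem {α β : ℝ} (hαβ : α < β) (hβ : β ≤ α + 2 * Real.pi) (s : ℝ) :
    boundaryParam α β s ∉ openAngle α β := by
  have hκ := angleExponent_pos hαβ
  -- Negative s go to the side β, since their argument is π. Zero goes to the vertex, and positive s
  -- go to the side α.
  rcases lt_trichotomy s 0 with hs | rfl | hs
  · have e : α + Real.pi * (angleExponent α β)⁻¹ = β := by
      rw [angleExponent, inv_div]; field_simp; ring
    rw [boundaryParam, angleParam, Complex.arg_ofReal_of_neg hs, e]
    exact polar_notMem_openAngle_right hβ (Real.rpow_pos_of_pos (by simpa using hs.ne) _)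
  · rw [boundaryParam, angleParam, Complex.ofReal_zero, norm_zero,
      Real.zero_rpow (inv_pos.2 hκ).ne', Complex.ofReal_zero, zero_mul]
    exact zero_notMem_openAngle α β
  · rw [boundaryParam, angleParam, Complex.arg_ofReal_of_nonneg hs.le, zero_mul, add_zero]
    exact polar_notMem_openAngle_left hβ (Real.rpow_pos_of_pos (by simpa using hs.ne') _)

theorem boundaryParam_mem_closure {α β : ℝ} (hαβ : α < β) (s : ℝ) :
    boundaryParam α β s ∈ closure (openAngle α β) := by
  have hsc : (s : ℂ) ∈ closure {w : ℂ | 0 < w.im} := by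
    rw [Complex.closure_setOfPred_lt_im]; simp
  have h1 : ContinuousWithinAt (angleParam α β) {w : ℂ | 0 < w.im} s :=
    ((continuousOn_angleParam hαβ) s (by simp)).mono fun w hw => (le_of_lt hw : 0 ≤ w.im)
  have h2 : angleParam α β '' {w : ℂ | 0 < w.im} ⊆ openAngle α β :=
    Set.image_subset_iff.2 fun w hw => angleParam_mem hαβ hw
  exact closure_mono h2 (h1.mem_closure_image hsc)

theorem coe_boundaryParam_mem {α β : ℝ} (hαβ : α < β) (hβ : β ≤ α + 2 * Real.pi) (s : ℝ) :
    (boundaryParam α β s : OnePoint ℂ) ∈ sphereBoundary (openAngle α β) := by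
  refine mem_sphereBoundary_of_mem_closure ?_ ?_
  · exact image_closure_subset_closure_image OnePoint.continuous_coe
      ⟨_, boundaryParam_mem_closure hαβ s, rfl⟩
  · rintro ⟨z, hz, h⟩
    exact boundaryParam_notMem hαβ hβ s (OnePoint.coe_injective h ▸ hz)

theorem tendsto_boundaryParam_infty {α β : ℝ} (hαβ : α < β) :
    Tendsto (fun s => (boundaryParam α β s : OnePoint ℂ)) (cocompact ℝ)
      (𝓝 (OnePoint.infty : OnePoint ℂ)) := by
  have h1 : Tendsto (boundaryParam α β) (cocompact ℝ) (cocompact ℂ) := by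
    rw [← Metric.cobounded_eq_cocompact (α := ℂ), ← tendsto_norm_atTop_iff_cobounded]
    simp only [norm_boundaryParam, ← Real.norm_eq_abs]
    exact (tendsto_rpow_atTop (inv_pos.2 (angleExponent_pos hαβ))).comp
      tendsto_norm_cocompact_atTop
  have h2 : Tendsto (fun z : ℂ => (z : OnePoint ℂ)) (cocompact ℂ) (𝓝 OnePoint.infty) := by
    rw [← coclosedCompact_eq_cocompact, ← OnePoint.comap_coe_nhds_infty]
    exact tendsto_comap
  exact h2.comp h1

theorem notMem_of_mem_sphereBoundary {D : Set ℂ} (hD : IsOpen D) {c : ℂ}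
    (hc : (c : OnePoint ℂ) ∈ sphereBoundary D) : c ∉ D := by
  intro h
  have ho : IsOpen ((fun z : ℂ => (z : OnePoint ℂ)) '' D) :=
    OnePoint.isOpenEmbedding_coe.isOpenMap D hD
  refine hc.2 ?_
  rw [ho.interior_eq]
  exact ⟨c, h, rfl⟩

/-! ### The Dirichlet problem in an angle -/

theorem tendsto_poissonIntegral_angle {α β : ℝ} (hαβ : α < β) (hβ : β ≤ α + 2 * Real.pi)
    {f : OnePoint ℂ → ℝ} (hf : ContinuousOn f (sphereBoundary (openAngle α β)))
    (hc : Continuous fun s => f (boundaryParam α β s)) {M : ℝ}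
    (hM : ∀ s, |f (boundaryParam α β s)| ≤ M) {ζ : OnePoint ℂ}
    (hζ : ζ ∈ sphereBoundary (openAngle α β)) :
    Tendsto (fun z => poissonIntegral (fun s => f (boundaryParam α β s)) (angleReduction α β z))
      (nhdsIn (openAngle α β) ζ) (𝓝 (f ζ)) := by
  have hκ := angleExponent_pos hαβ
  induction ζ using OnePoint.rec with
  | infty =>
    have hlim : Tendsto (fun s => f (boundaryParam α β s)) (cocompact ℝ) (𝓝 (f OnePoint.infty)) :=
      (hf _ hζ).tendsto.comp (tendsto_nhdsWithin_iff.2 ⟨tendsto_boundaryParam_infty hαβ,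
        Eventually.of_forall (coe_boundaryParam_mem hαβ hβ)⟩)
    refine (tendsto_poissonIntegral_infty hc hM hlim).comp ?_
    rw [nhdsIn, OnePoint.comap_coe_nhds_infty, coclosedCompact_eq_cocompact]
    refine tendsto_inf.2 ⟨?_, ?_⟩
    · rw [← Metric.cobounded_eq_cocompact (α := ℂ), ← tendsto_norm_atTop_iff_cobounded]
      have : Tendsto (fun z : ℂ => ‖z‖ ^ angleExponent α β) 
          (Bornology.cobounded ℂ ⊓ 𝓟 (openAngle α β)) atTop :=
        ((tendsto_rpow_atTop hκ).comp tendsto_norm_cobounded_atTop).mono_left inf_le_left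
      refine this.congr' ?_
      filter_upwards [mem_inf_of_right (mem_principal_self _)] with z hz
      exact (norm_angleReduction hβ hz).symm
    · refine tendsto_principal.2 ?_
      filter_upwards [mem_inf_of_right (mem_principal_self _)] with z hz
      exact angleReduction_im_pos hβ hz
  | coe c =>
    have hcD := notMem_of_mem_sphereBoundary (isOpen_openAngle hβ) hζ
    rw [nhdsIn, ← OnePoint.isOpenEmbedding_coe.isInducing.nhds_eq_comap]
    -- When β = α + 2π a boundary point can have two real preimages, one for each side of the slit,
    -- and `angleReduction` then has no limit. An ultrafilter selects one preimage w, and the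
    -- Poisson integral takes the value f c at either of them.
    rw [tendsto_iff_ultrafilter]
    intro 𝒰 h𝒰
    have hUc : (𝒰 : Filter ℂ) ≤ 𝓝 c := h𝒰.trans inf_le_left
    have hUD : ∀ᶠ z in (𝒰 : Filter ℂ), z ∈ openAngle α β :=
      (h𝒰.trans inf_le_right) (mem_principal_self _)
    set K : Set ℂ := Metric.closedBall 0 ((‖c‖ + 1) ^ angleExponent α β) ∩ {w | 0 ≤ w.im} with hK
    have hKc : IsCompact K := (isCompact_closedBall _ _).inter_right
      (isClosed_le continuous_const Complex.continuous_im)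
    have hUK : ∀ᶠ z in (𝒰 : Filter ℂ), angleReduction α β z ∈ K := by
      filter_upwards [hUD, hUc (Metric.ball_mem_nhds c one_pos)] with z hz hz1
      refine ⟨?_, (angleReduction_im_pos hβ hz).le⟩
      rw [mem_closedBall_zero_iff, norm_angleReduction hβ hz]
      refine Real.rpow_le_rpow (norm_nonneg _) ?_ hκ.le
      have := norm_le_norm_add_norm_sub c z
      rw [Metric.mem_ball, dist_comm, dist_eq_norm] at hz1
      linarith [norm_sub_rev c z]
    obtain ⟨w, hwK, hw⟩ := isCompact_iff_ultrafilter_le_nhds.1 hKc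
      (𝒰.map (angleReduction α β)) (le_principal_iff.2 hUK)
    have hw' : Tendsto (angleReduction α β) 𝒰 (𝓝 w) := hw
    have hg : Tendsto (fun z => angleParam α β (angleReduction α β z)) 𝒰
        (𝓝 (angleParam α β w)) :=
      ((continuousOn_angleParam hαβ) w hwK.2).tendsto.comp (tendsto_nhdsWithin_iff.2
        ⟨hw', hUK.mono fun z hz => hz.2⟩)
    have hcw : angleParam α β w = c := by
      refine tendsto_nhds_unique hg (Tendsto.congr' ?_ hUc)
      filter_upwards [hUD] with z hz
      exact (angleParam_angleReduction hβ hz).symm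
    have him : w.im = 0 := by
      by_contra h
      exact hcD (hcw ▸ angleParam_mem hαβ (lt_of_le_of_ne hwK.2 (Ne.symm h)))
    have hwre : w = (w.re : ℂ) := Complex.ext rfl (by simp [him])
    have hfin := ((continuous_poissonIntegral hc hM).tendsto w).comp hw'
    have e : poissonIntegral (fun s => f (boundaryParam α β s)) w = f c := by
      rw [hwre, poissonIntegral_ofReal, boundaryParam, ← hwre, hcw]
    rw [e] at hfin
    exact hfin

/-- The harmonic measure of `∠(α, β)` at `z`, as the image of that of the half-plane. -/
def angleMeasure (α β : ℝ) (z : ℂ) : Measure ℂ :=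
  (halfPlaneMeasure (angleReduction α β z)).map (boundaryParam α β)

theorem isProbabilityMeasure_angleMeasure {α β : ℝ} (hαβ : α < β) (hβ : β ≤ α + 2 * Real.pi)
    {z : ℂ} (hz : z ∈ openAngle α β) : IsProbabilityMeasure (angleMeasure α β z) := by
  have := isProbabilityMeasure_halfPlaneMeasure (angleReduction_im_pos hβ hz)
  exact Measure.isProbabilityMeasure_map (continuous_boundaryParam hαβ).aemeasurable

theorem measurableEmbedding_coe_sphere : MeasurableEmbedding (fun z : ℂ => (z : OnePoint ℂ)) :=
  OnePoint.isOpenEmbedding_coe.measurableEmbedding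

theorem isHarmonicMeasure_angle {α β : ℝ} (hαβ : α < β) (hβ : β ≤ α + 2 * Real.pi)
    {z : ℂ} (hz : z ∈ openAngle α β) :
    IsHarmonicMeasure (openAngle α β) z
      ((angleMeasure α β z).map (fun z : ℂ => (z : OnePoint ℂ))) := by
  have hprob := isProbabilityMeasure_angleMeasure hαβ hβ hz
  have hbm : MeasurableSet (sphereBoundary (openAngle α β)) := isClosed_frontier.measurableSet
  have hmb : Measurable (boundaryParam α β) := (continuous_boundaryParam hαβ).measurable
  have hcoe := measurableEmbedding_coe_sphere.measurable
  have hcb : Measurable fun s => (boundaryParam α β s : OnePoint ℂ) := hcoe.comp hmb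
  have hmap : (angleMeasure α β z).map (fun z : ℂ => (z : OnePoint ℂ))
      = (halfPlaneMeasure (angleReduction α β z)).map
        (fun s => (boundaryParam α β s : OnePoint ℂ)) := by
    rw [angleMeasure, Measure.map_map hcoe hmb]; rfl
  have hnull : (angleMeasure α β z).map (fun z : ℂ => (z : OnePoint ℂ))
      (sphereBoundary (openAngle α β))ᶜ = 0 := by
    rw [hmap, Measure.map_apply hcb hbm.compl]
    convert measure_empty (μ := halfPlaneMeasure (angleReduction α β z))
    ext s
    simpa using coe_boundaryParam_mem hαβ hβ s
  refine ⟨inferInstance, hnull, fun f hf => ?_⟩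
  have hc : Continuous fun s => f (boundaryParam α β s) :=
    hf.comp_continuous (OnePoint.continuous_coe.comp (continuous_boundaryParam hαβ))
      (coe_boundaryParam_mem hαβ hβ)
  obtain ⟨M, hM⟩ := (isClosed_frontier.isCompact : IsCompact
    (sphereBoundary (openAngle α β))).exists_bound_of_continuousOn hf
  have hM' : ∀ s, |f (boundaryParam α β s)| ≤ M := fun s =>
    hM _ (coe_boundaryParam_mem hαβ hβ s)
  have hWim : ∀ z ∈ openAngle α β, 0 < (angleReduction α β z).im := fun z hz =>
    angleReduction_im_pos hβ hz
  rw [perron_eq_of_meanValue (isOpen_openAngle hβ)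
    (F := fun z => poissonIntegral (fun s => f (boundaryParam α β s)) (angleReduction α β z))
    ((continuous_poissonIntegral hc hM').comp_continuousOn
      (differentiableOn_angleReduction hβ).continuousOn)
    (fun z r hr hzr => circleAverage_poissonIntegral (differentiableOn_angleReduction hβ)
      hWim hr hzr hc hM')
    (fun ζ hζ => tendsto_poissonIntegral_angle hαβ hβ hf hc hM' hζ) hz]
  congr 1
  have hres : ((angleMeasure α β z).map (fun z : ℂ => (z : OnePoint ℂ))).restrict
      (sphereBoundary (openAngle α β))
      = (angleMeasure α β z).map (fun z : ℂ => (z : OnePoint ℂ)) :=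
    Measure.restrict_eq_self_of_ae_mem (mem_ae_iff.2 hnull)
  have hsm := hf.aestronglyMeasurable (μ := (angleMeasure α β z).map
    (fun z : ℂ => (z : OnePoint ℂ))) hbm
  rw [hres] at hsm ⊢
  rw [hmap] at hsm ⊢
  rw [integral_map hcb.aemeasurable hsm, poissonIntegral_eq (hWim z hz)]

/-- Stereographic projection identifies the one-point compactification with a round sphere.
Metrizability lets continuous functions separate finite Borel measures. -/
theorem metrizableSpace_sphere : TopologicalSpace.MetrizableSpace (OnePoint ℂ) :=
  (onePointEquivSphereOfFinrankEq (ι := Fin 3) (V := ℂ)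
    (by simp [Complex.finrank_real_complex])).isEmbedding.metrizableSpace

/-- As `harmonicMeasure` is an arbitrary choice among the measures satisfying the definition,
uniqueness is what allows it to be computed. -/
theorem IsHarmonicMeasure.unique {D : Set ℂ} {z : ℂ} {μ μ' : Measure (OnePoint ℂ)}
    (h : IsHarmonicMeasure D z μ) (h' : IsHarmonicMeasure D z μ') : μ = μ' := by
  have := metrizableSpace_sphere
  have := h.1
  have := h'.1
  refine ext_of_forall_integral_eq_of_IsFiniteMeasure fun f => ?_
  have e : ∀ {μ : Measure (OnePoint ℂ)}, IsHarmonicMeasure D z μ →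
      ((∫ w, f w ∂μ : ℝ) : EReal) = perron D f z := fun {μ} h => by
    have hres : μ.restrict (sphereBoundary D) = μ :=
      Measure.restrict_eq_self_of_ae_mem (mem_ae_iff.2 h.2.1)
    rw [← h.2.2 f f.continuous.continuousOn, hres]
  exact_mod_cast (e h).trans (e h').symm

theorem harmonicMeasure_openAngle {α β : ℝ} (hαβ : α < β) (hβ : β ≤ α + 2 * Real.pi)
    {z : ℂ} (hz : z ∈ openAngle α β) :
    harmonicMeasure (openAngle α β) z
      = (angleMeasure α β z).map (fun z : ℂ => (z : OnePoint ℂ)) := by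
  have hex : ∃ μ, IsHarmonicMeasure (openAngle α β) z μ := ⟨_, isHarmonicMeasure_angle hαβ hβ hz⟩
  rw [harmonicMeasure, dif_pos hex]
  exact hex.choose_spec.unique (isHarmonicMeasure_angle hαβ hβ hz)

/-! ### The components of the complement of a system of rays -/

theorem exists_polar (α : ℝ) {z : ℂ} (hz : z ≠ 0) :
    ∃ r θ : ℝ, 0 < r ∧ α ≤ θ ∧ θ < α + 2 * Real.pi ∧
      z = (r : ℂ) * Complex.exp (θ * Complex.I) := by
  refine ⟨‖z‖, toIcoMod Real.two_pi_pos α z.arg, norm_pos_iff.2 hz, left_le_toIcoMod _ _ _,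
    toIcoMod_lt_right _ _ _, ?_⟩
  have h1 := self_sub_toIcoMod Real.two_pi_pos α z.arg
  have h2 : ((toIcoMod Real.two_pi_pos α z.arg : ℝ) : ℂ) * Complex.I
      = z.arg * Complex.I - (toIcoDiv Real.two_pi_pos α z.arg : ℤ) * (2 * Real.pi * Complex.I) := by
    rw [zsmul_eq_mul] at h1
    have h3 : toIcoMod Real.two_pi_pos α z.arg
      = z.arg - (toIcoDiv Real.two_pi_pos α z.arg : ℤ) * (2 * Real.pi) := by linarith
    rw [h3]; push_cast; ring
  rw [h2, Complex.exp_periodic.sub_int_mul_eq, Complex.norm_mul_exp_arg_mul_I]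

theorem isPreconnected_openAngle (α β : ℝ) : IsPreconnected (openAngle α β) := by
  have h1 : IsPreconnected (Set.Ioi (0 : ℝ) ×ˢ Set.Ioo α β) :=
    isPreconnected_Ioi.prod isPreconnected_Ioo
  have h2 : Continuous fun q : ℝ × ℝ => (q.1 : ℂ) * Complex.exp ((q.2 : ℂ) * Complex.I) := by
    fun_prop
  convert h1.image _ h2.continuousOn using 1
  ext z
  constructor
  · rintro ⟨r, θ, hr, ha, hb, rfl⟩
    exact ⟨(r, θ), ⟨hr, ha, hb⟩, rfl⟩
  · rintro ⟨⟨r, θ⟩, ⟨hr, ha, hb⟩, rfl⟩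
    exact ⟨r, θ, hr, ha, hb, rfl⟩

theorem disjoint_openAngle {α β γ : ℝ} (hγ : γ ≤ α + 2 * Real.pi) :
    Disjoint (openAngle α β) (openAngle β γ) := by
  rw [Set.disjoint_left]
  rintro _ ⟨r, θ, hr, h1, h2, rfl⟩ ⟨r', θ', hr', h1', h2', h⟩
  obtain ⟨n, hn⟩ := eq_add_two_pi_mul_of_polar_eq hr hr' h
  have hpi := Real.pi_pos
  have hn0 : (n : ℝ) < 0 := by
    by_contra! hc
    nlinarith
  have hn1 : (n : ℝ) ≤ -1 := by
    have : n < 0 := by exact_mod_cast hn0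
    exact_mod_cast (by omega : n ≤ -1)
  nlinarith

/-- The angle from β to α + 2π is open and disjoint from ∠(α, β), so it does not meet the closure.
Only the sides and the vertex remain. -/
theorem closure_openAngle_subset {α β : ℝ} (hαβ : α < β) (hβ : β ≤ α + 2 * Real.pi) {z : ℂ}
    (hz : z ∈ closure (openAngle α β)) : z ∈ openAngle α β ∨ z = 0 ∨
      (∃ r : ℝ, 0 < r ∧ z = (r : ℂ) * Complex.exp (α * Complex.I)) ∨
      ∃ r : ℝ, 0 < r ∧ z = (r : ℂ) * Complex.exp (β * Complex.I) := by
  by_cases h0 : z = 0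
  · exact Or.inr (Or.inl h0)
  obtain ⟨r, θ, hr, h1, h2, rfl⟩ := exists_polar α h0
  rcases h1.eq_or_lt with rfl | h1
  · exact Or.inr (Or.inr (Or.inl ⟨r, hr, rfl⟩))
  rcases lt_trichotomy θ β with h | rfl | h
  · exact Or.inl ⟨r, θ, hr, h1, h, rfl⟩
  · exact Or.inr (Or.inr (Or.inr ⟨r, hr, rfl⟩))
  · have hd := (disjoint_openAngle (α := α) (β := β) (γ := α + 2 * Real.pi) le_rfl)
    have ho : IsOpen (openAngle β (α + 2 * Real.pi)) := isOpen_openAngle (by linarith)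
    exact absurd ⟨r, θ, hr, h, h2, rfl⟩ (Set.disjoint_left.1 (hd.closure_left ho) hz)

theorem IsClosedRaySystem.zero_mem {S : Set ℂ} (hS : IsClosedRaySystem S) : (0 : ℂ) ∈ S := by
  obtain ⟨-, Θ, ⟨u, hu⟩, rfl⟩ := hS
  exact Set.mem_biUnion hu ⟨0, le_rfl, by simp⟩

theorem IsClosedRaySystem.mul_mem {S : Set ℂ} (hS : IsClosedRaySystem S) {t : ℝ} (ht : 0 ≤ t)
    {z : ℂ} (hz : z ∈ S) : (t : ℂ) * z ∈ S := by
  obtain ⟨-, Θ, -, rfl⟩ := hS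
  simp only [Set.mem_iUnion, exists_prop] at hz ⊢
  obtain ⟨u, hu, s, hs, rfl⟩ := hz
  exact ⟨u, hu, t * s, mul_nonneg ht hs, by push_cast; ring⟩

theorem IsClosedRaySystem.mul_mem_iff {S : Set ℂ} (hS : IsClosedRaySystem S) {t : ℝ} (ht : 0 < t)
    {z : ℂ} : (t : ℂ) * z ∈ S ↔ z ∈ S := by
  refine ⟨fun h => ?_, hS.mul_mem ht.le⟩
  have := hS.mul_mem (inv_pos.2 ht).le h
  rwa [Complex.ofReal_inv, inv_mul_cancel_left₀ (Complex.ofReal_ne_zero.2 ht.ne')] at this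

/-- The arguments of directions in S form a closed 2π-periodic set T, and α, β are its nearest
elements on either side of the argument of z. The angle between them is connected and misses S. It
is also relatively closed in the component, because its closure adds only points of S. -/
theorem exists_openAngle_eq_connectedComponentIn {S : Set ℂ} (hS : IsClosedRaySystem S) {z : ℂ}
    (hz : z ∉ S) : ∃ α β : ℝ, α < β ∧ β ≤ α + 2 * Real.pi ∧
      openAngle α β = connectedComponentIn Sᶜ z := by
  have h0 : z ≠ 0 := fun h => hz (h ▸ hS.zero_mem)
  obtain ⟨r, θ₀, hr, -, -, hzp⟩ := exists_polar 0 h0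
  set T : Set ℝ := {θ | Complex.exp (θ * Complex.I) ∈ S} with hT
  have hTc : IsClosed T := hS.1.preimage (by fun_prop)
  have hθ₀ : θ₀ ∉ T := fun h => hz (hzp ▸ hS.mul_mem hr.le h)
  have hper : ∀ θ ∈ T, θ + 2 * Real.pi ∈ T := fun θ h => by
    have : ((θ + 2 * Real.pi : ℝ) : ℂ) * Complex.I
      = θ * Complex.I + 2 * Real.pi * Complex.I := by push_cast; ring
    rw [hT, Set.mem_ofPred_eq, this, Complex.exp_periodic]
    exact h
  obtain ⟨u, hu⟩ : ∃ u : Circle, (u : ℂ) ∈ S := by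
    obtain ⟨-, Θ, ⟨u, hu⟩, rfl⟩ := hS
    exact ⟨u, Set.mem_biUnion hu ⟨1, zero_le_one, by simp⟩⟩
  have hex : ∀ a : ℝ, ∃ θ ∈ T, a ≤ θ ∧ θ < a + 2 * Real.pi := fun a => by
    obtain ⟨t, θ, ht, h1, h2, h3⟩ := exists_polar a (Circle.coe_ne_zero u)
    exact ⟨θ, (hS.mul_mem_iff ht).1 (h3 ▸ hu), h1, h2⟩
  set α := sSup (T ∩ Set.Iic θ₀) with hα
  set β := sInf (T ∩ Set.Ici θ₀) with hβ
  have hba : BddAbove (T ∩ Set.Iic θ₀) := ⟨θ₀, fun x hx => hx.2⟩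
  have hbb : BddBelow (T ∩ Set.Ici θ₀) := ⟨θ₀, fun x hx => hx.2⟩
  have hαm : α ∈ T ∩ Set.Iic θ₀ := by
    obtain ⟨θ, h1, h2, h3⟩ := hex (θ₀ - 2 * Real.pi)
    exact (hTc.inter isClosed_Iic).csSup_mem ⟨θ, h1, by simp only [Set.mem_Iic]; linarith⟩ hba
  have hβm : β ∈ T ∩ Set.Ici θ₀ := by
    obtain ⟨θ, h1, h2, h3⟩ := hex θ₀
    exact (hTc.inter isClosed_Ici).csInf_mem ⟨θ, h1, h2⟩ hbb
  have hα0 : α < θ₀ := lt_of_le_of_ne hαm.2 fun h => hθ₀ (h ▸ hαm.1)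
  have hβ0 : θ₀ < β := lt_of_le_of_ne hβm.2 fun h => hθ₀ (h ▸ hβm.1)
  -- By periodicity α + 2π is in T. It is at least θ₀, since otherwise it would exceed the supremum
  -- α.
  have hαβ : β ≤ α + 2 * Real.pi := by
    refine csInf_le hbb ⟨hper α hαm.1, ?_⟩
    by_contra! h
    have : α + 2 * Real.pi ≤ α := le_csSup hba ⟨hper α hαm.1, (not_le.1 (show ¬θ₀ ≤ _ from h)).le⟩
    linarith [Real.pi_pos]
  have hsub : openAngle α β ⊆ Sᶜ := by
    rintro _ ⟨t, θ, ht, h1, h2, rfl⟩ hmem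
    have hθT : θ ∈ T := (hS.mul_mem_iff ht).1 hmem
    rcases le_total θ θ₀ with h | h
    · exact absurd (le_csSup hba ⟨hθT, h⟩) (not_le.2 h1)
    · exact absurd (csInf_le hbb ⟨hθT, h⟩) (not_le.2 h2)
  have hzD : z ∈ openAngle α β := ⟨r, θ₀, hr, hα0, hβ0, hzp⟩
  refine ⟨α, β, hα0.trans hβ0, hαβ, Set.Subset.antisymm ?_ ?_⟩
  · exact (isPreconnected_openAngle α β).subset_connectedComponentIn hzD hsub
  · refine isPreconnected_connectedComponentIn.subset_of_closure_inter_subset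
      (isOpen_openAngle hαβ) ⟨z, mem_connectedComponentIn hz, hzD⟩ ?_
    rintro w ⟨hw, hwc⟩
    have hwS : w ∉ S := connectedComponentIn_subset _ _ hwc
    rcases closure_openAngle_subset (hα0.trans hβ0) hαβ hw with h | rfl | ⟨t, ht, rfl⟩ | ⟨t, ht, rfl⟩
    · exact h
    · exact absurd hS.zero_mem hwS
    · exact absurd (hS.mul_mem ht.le hαm.1) hwS
    · exact absurd (hS.mul_mem ht.le hβm.1) hwS

theorem IsComplementaryAngle.subset_compl {S : Set ℂ} {α β : ℝ} (h : IsComplementaryAngle S α β) :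
    openAngle α β ⊆ Sᶜ := by
  obtain ⟨-, -, z, -, e⟩ := h
  exact e ▸ connectedComponentIn_subset _ _

theorem IsComplementaryAngle.eq_connectedComponentIn {S : Set ℂ} {α β : ℝ}
    (h : IsComplementaryAngle S α β) {z : ℂ} (hz : z ∈ openAngle α β) :
    connectedComponentIn Sᶜ z = openAngle α β := by
  obtain ⟨-, -, w, -, e⟩ := h
  rw [e] at hz ⊢
  exact (connectedComponentIn_eq hz).symm

/-- The set of angles complementary to `S`. -/
def complementaryAngles (S : Set ℂ) : Set (Set ℂ) :=
  {A | ∃ α β : ℝ, IsComplementaryAngle S α β ∧ A = openAngle α β}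

theorem exists_mem_complementaryAngles {S : Set ℂ} (hS : IsClosedRaySystem S) {z : ℂ}
    (hz : z ∉ S) : ∃ A ∈ complementaryAngles S, z ∈ A := by
  obtain ⟨α, β, h1, h2, h3⟩ := exists_openAngle_eq_connectedComponentIn hS hz
  exact ⟨_, ⟨α, β, ⟨h1, h2, z, hz, h3⟩, rfl⟩, h3 ▸ mem_connectedComponentIn hz⟩

theorem pairwiseDisjoint_complementaryAngles (S : Set ℂ) :
    (complementaryAngles S).PairwiseDisjoint id := by
  rintro A ⟨α, β, h, rfl⟩ B ⟨α', β', h', rfl⟩ hne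
  refine Set.disjoint_left.2 fun z hz hz' => hne ?_
  rw [← h.eq_connectedComponentIn hz, ← h'.eq_connectedComponentIn hz']

theorem countable_complementaryAngles (S : Set ℂ) : (complementaryAngles S).Countable := by
  refine (pairwiseDisjoint_complementaryAngles S).countable_of_isOpen ?_ ?_
  · rintro A ⟨α, β, h, rfl⟩
    exact isOpen_openAngle h.2.1
  · rintro A ⟨α, β, ⟨-, -, z, hz, e⟩, rfl⟩
    exact ⟨z, e ▸ mem_connectedComponentIn hz⟩

/-! ### Counting wide angles -/

/-- The angular measure of the set of directions of a plane set. -/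
def angularLength (A : Set ℂ) : ℝ :=
  ∫ θ in (0 : ℝ)..2 * Real.pi, A.indicator 1 (Complex.exp (θ * Complex.I))

theorem intervalIntegrable_indicator_exp {A : Set ℂ} (hA : MeasurableSet A) (a b : ℝ) :
    IntervalIntegrable (fun θ : ℝ => A.indicator (1 : ℂ → ℝ) (Complex.exp (θ * Complex.I)))
      volume a b := by
  have hm : Measurable fun θ : ℝ => A.indicator (1 : ℂ → ℝ) (Complex.exp (θ * Complex.I)) :=
    (measurable_one.indicator hA).comp (by fun_prop)
  refine (intervalIntegrable_const (c := (1 : ℝ))).mono_fun hm.aestronglyMeasurable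
    (ae_of_all _ fun θ => ?_)
  simpa using norm_indicator_le_norm_self (1 : ℂ → ℝ) (Complex.exp (θ * Complex.I))

/-- By 2π-periodicity the integral may start at α, and the indicator equals 1 on (α, β). -/
theorem le_angularLength {α β : ℝ} (hαβ : α < β) (hβ : β ≤ α + 2 * Real.pi) :
    β - α ≤ angularLength (openAngle α β) := by
  have hm : MeasurableSet (openAngle α β) := (isOpen_openAngle hβ).measurableSet
  set g : ℝ → ℝ := fun θ => (openAngle α β).indicator (1 : ℂ → ℝ) (Complex.exp (θ * Complex.I))
    with hg
  have hper : Function.Periodic g (2 * Real.pi) := fun θ => by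
    have : ((θ + 2 * Real.pi : ℝ) : ℂ) * Complex.I
      = θ * Complex.I + 2 * Real.pi * Complex.I := by push_cast; ring
    simp only [hg, this, Complex.exp_periodic _]
  have h1 : angularLength (openAngle α β) = ∫ θ in α..α + 2 * Real.pi, g θ := by
    rw [angularLength, hper.intervalIntegral_add_eq α 0, zero_add]
  rw [h1, ← intervalIntegral.integral_add_adjacent_intervals (b := β)
    (intervalIntegrable_indicator_exp hm _ _) (intervalIntegrable_indicator_exp hm _ _)]
  have h2 : 0 ≤ ∫ θ in β..α + 2 * Real.pi, g θ :=
    intervalIntegral.integral_nonneg hβ fun θ _ => Set.indicator_nonneg (fun _ _ => zero_le_one) _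
  have h3 : ∫ θ in α..β, g θ = ∫ θ in α..β, (1 : ℝ) := by
    rw [intervalIntegral.integral_of_le hαβ.le, intervalIntegral.integral_of_le hαβ.le,
      integral_Ioc_eq_integral_Ioo, integral_Ioc_eq_integral_Ioo]
    refine setIntegral_congr_fun measurableSet_Ioo fun θ hθ => ?_
    have : Complex.exp (θ * Complex.I) ∈ openAngle α β := ⟨1, θ, one_pos, hθ.1, hθ.2, by simp⟩
    simp [hg, this]
  rw [h3, intervalIntegral.integral_const, smul_eq_mul, mul_one]
  linarith

theorem sum_angularLength_le {s : Finset (Set ℂ)} (hd : (s : Set (Set ℂ)).PairwiseDisjoint id)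
    (hm : ∀ A ∈ s, MeasurableSet A) : ∑ A ∈ s, angularLength A ≤ 2 * Real.pi := by
  have hle : ∀ z : ℂ, ∑ A ∈ s, A.indicator (1 : ℂ → ℝ) z ≤ 1 := by
    intro z
    by_cases h : ∃ A ∈ s, z ∈ A
    · obtain ⟨A, hA, hz⟩ := h
      rw [Finset.sum_eq_single_of_mem A hA]
      · simp [hz]
      · intro B hB hne
        refine Set.indicator_of_notMem (fun hzB => ?_) _
        exact Set.disjoint_left.1 (hd hB hA hne) hzB hz
    · push Not at h
      rw [Finset.sum_eq_zero fun A hA => Set.indicator_of_notMem (h A hA) _]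
      exact zero_le_one
  unfold angularLength
  rw [← intervalIntegral.integral_finsetSum
    fun A hA => intervalIntegrable_indicator_exp (hm A hA) _ _]
  have := intervalIntegral.integral_mono_on (a := 0) (b := 2 * Real.pi) Real.two_pi_pos.le
    (IntervalIntegrable.sum s fun A hA => intervalIntegrable_indicator_exp (hm A hA) _ _)
    (intervalIntegrable_const (c := (1 : ℝ))) (fun θ _ => by
      simpa using hle (Complex.exp (θ * Complex.I)))
  simpa using this

/-- The complementary angles of opening at least `π / p`. -/
def wideAngles (S : Set ℂ) (p : ℝ) : Set (Set ℂ) :=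
  {A | ∃ α β : ℝ, IsComplementaryAngle S α β ∧ Real.pi ≤ p * (β - α) ∧ A = openAngle α β}

theorem wideAngles_subset (S : Set ℂ) (p : ℝ) : wideAngles S p ⊆ complementaryAngles S := by
  rintro A ⟨α, β, h, -, e⟩
  exact ⟨α, β, h, e⟩

/-- Disjoint angles have total angular length at most 2π, and each of these has p times its length
at least π. In this product form the condition fails for every angle when p = 0. -/
theorem card_le_of_subset_wideAngles {S : Set ℂ} {p : ℝ} (hp : 0 ≤ p) {s : Finset (Set ℂ)}
    (hs : (s : Set (Set ℂ)) ⊆ wideAngles S p) : (s.card : ℝ) ≤ 2 * p := by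
  have hd : (s : Set (Set ℂ)).PairwiseDisjoint id :=
    (pairwiseDisjoint_complementaryAngles S).subset (hs.trans (wideAngles_subset S p))
  have h1 := sum_angularLength_le hd fun A hA => by
    obtain ⟨α, β, h, -, rfl⟩ := hs hA
    exact (isOpen_openAngle h.2.1).measurableSet
  have h2 : ∑ _A ∈ s, Real.pi ≤ ∑ A ∈ s, p * angularLength A := Finset.sum_le_sum fun A hA => by
    obtain ⟨α, β, h, hpi, rfl⟩ := hs hA
    exact hpi.trans (mul_le_mul_of_nonneg_left (le_angularLength h.1 h.2.1) hp)
  rw [Finset.sum_const, nsmul_eq_mul, ← Finset.mul_sum] at h2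
  have hpi := Real.pi_pos
  have h3 : s.card * Real.pi ≤ (2 * p) * Real.pi :=
    h2.trans ((mul_le_mul_of_nonneg_left h1 hp).trans (by linarith))
  exact le_of_mul_le_mul_right h3 hpi

theorem finite_wideAngles (S : Set ℂ) {p : ℝ} (hp : 0 ≤ p) : (wideAngles S p).Finite := by
  by_contra h
  obtain ⟨s, hs, hcard⟩ := Set.Infinite.exists_subset_card_eq h (⌊2 * p⌋₊ + 1)
  have h1 := card_le_of_subset_wideAngles hp hs
  rw [hcard] at h1
  push_cast at h1
  linarith [Nat.lt_floor_add_one (2 * p)]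

theorem ncard_wideAngles_le (S : Set ℂ) {p : ℝ} (hp : 0 ≤ p) :
    ((wideAngles S p).ncard : ℝ) ≤ 2 * p := by
  rw [Set.ncard_eq_toFinset_card _ (finite_wideAngles S hp)]
  exact card_le_of_subset_wideAngles (S := S) hp (by simp)

/-! ### Estimates of harmonic measure in an angle -/

theorem boundaryParam_preimage_closedBall {α β r : ℝ} (hαβ : α < β) (hr : 0 ≤ r) :
    boundaryParam α β ⁻¹' Metric.closedBall 0 r
      = Set.Icc (-r ^ angleExponent α β) (r ^ angleExponent α β) := by
  ext s
  rw [Set.mem_preimage, mem_closedBall_zero_iff, norm_boundaryParam,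
    Real.rpow_inv_le_iff_of_pos (abs_nonneg s) hr (angleExponent_pos hαβ), abs_le, Set.mem_Icc]

theorem boundaryParam_preimage_ball {α β r : ℝ} (hαβ : α < β) (hr : 0 ≤ r) :
    boundaryParam α β ⁻¹' Metric.ball 0 r
      = Set.Ioo (-r ^ angleExponent α β) (r ^ angleExponent α β) := by
  ext s
  rw [Set.mem_preimage, mem_ball_zero_iff, norm_boundaryParam,
    Real.rpow_inv_lt_iff_of_pos (abs_nonneg s) hr (angleExponent_pos hαβ), abs_lt, Set.mem_Ioo]

theorem angleMeasure_closedBall_le {α β : ℝ} (hαβ : α < β) (hβ : β ≤ α + 2 * Real.pi) {z : ℂ}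
    (hz : z ∈ openAngle α β) {r : ℝ} (hr : 0 ≤ r) (hzr : 4 * r ≤ ‖z‖) :
    angleMeasure α β z (Metric.closedBall 0 r) ≤ ENNReal.ofReal
      (8 / Real.pi * r ^ angleExponent α β * -(1 / angleReduction α β z).im) := by
  rw [angleMeasure, Measure.map_apply (continuous_boundaryParam hαβ).measurable
    Metric.isClosed_closedBall.measurableSet, boundaryParam_preimage_closedBall hαβ hr]
  refine halfPlaneMeasure_Icc_le (angleReduction_im_pos hβ hz) (by positivity) ?_
  have hκ := angleExponent_pos hαβ
  rw [norm_angleReduction hβ hz]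
  -- The opening is at most 2π, so κ ≥ 1/2 and 4^κ ≥ 2. This is why |z| ≥ 4r suffices for ‖w‖ ≥ 2
  -- r^κ.
  have h4 : (2 : ℝ) ≤ 4 ^ angleExponent α β := by
    calc (2 : ℝ) = 4 ^ (1 / 2 : ℝ) := by
          rw [← Real.sqrt_eq_rpow, show (4 : ℝ) = 2 ^ 2 by norm_num, Real.sqrt_sq zero_le_two]
      _ ≤ _ := Real.rpow_le_rpow_of_exponent_le (by norm_num) (half_le_angleExponent hαβ hβ)
  calc 2 * r ^ angleExponent α β ≤ 4 ^ angleExponent α β * r ^ angleExponent α β := by gcongr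
    _ = (4 * r) ^ angleExponent α β := (Real.mul_rpow (by norm_num) hr).symm
    _ ≤ _ := by gcongr

theorem neg_one_div_angleReduction_im_le {α β : ℝ} (hβ : β ≤ α + 2 * Real.pi) {z : ℂ}
    (hz : z ∈ openAngle α β) :
    -(1 / angleReduction α β z).im ≤ (‖z‖ ^ angleExponent α β)⁻¹ := by
  have him := angleReduction_im_pos hβ hz
  have h0 : 0 < ‖angleReduction α β z‖ :=
    norm_pos_iff.2 fun h => by rw [h] at him; simp at him
  rw [neg_one_div_im, ← norm_angleReduction hβ hz, ← one_div,
    div_le_div_iff₀ (by positivity) h0]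
  nlinarith [Complex.im_le_norm (angleReduction α β z)]

/-- As r/|z| ≤ 1, the exponent κ can be lowered to any q ≤ κ. This gives one bound for all narrow
angles at once. -/
theorem angleMeasure_closedBall_le_rpow {α β : ℝ} (hαβ : α < β) (hβ : β ≤ α + 2 * Real.pi)
    {z : ℂ} (hz : z ∈ openAngle α β) {r : ℝ} (hr : 0 < r) (hzr : 4 * r ≤ ‖z‖) {q : ℝ}
    (hq : q ≤ angleExponent α β) :
    angleMeasure α β z (Metric.closedBall 0 r)
      ≤ ENNReal.ofReal (8 / Real.pi) * ENNReal.ofReal ((r / ‖z‖) ^ q) := by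
  have hz0 : 0 < ‖z‖ := by linarith
  rw [← ENNReal.ofReal_mul (by positivity)]
  refine (angleMeasure_closedBall_le hαβ hβ hz hr.le hzr).trans (ENNReal.ofReal_le_ofReal ?_)
  calc 8 / Real.pi * r ^ angleExponent α β * -(1 / angleReduction α β z).im
      ≤ 8 / Real.pi * r ^ angleExponent α β * (‖z‖ ^ angleExponent α β)⁻¹ := by
        gcongr; exact neg_one_div_angleReduction_im_le hβ hz
    _ = 8 / Real.pi * (r / ‖z‖) ^ angleExponent α β := by
        rw [Real.div_rpow hr.le hz0.le]; ring
    _ ≤ 8 / Real.pi * (r / ‖z‖) ^ q := by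
        refine mul_le_mul_of_nonneg_left ?_ (by positivity)
        refine Real.rpow_le_rpow_of_exponent_ge (by positivity) ?_ hq
        rw [div_le_one hz0]; linarith

theorem le_angleMeasure_ball {α β : ℝ} (hαβ : α < β) (hβ : β ≤ α + 2 * Real.pi) {z : ℂ}
    (hz : z ∈ openAngle α β) {r : ℝ} (hr : 0 ≤ r) (hzr : r ≤ ‖z‖) :
    ENNReal.ofReal (r ^ angleExponent α β / (2 * Real.pi) * -(1 / angleReduction α β z).im)
      ≤ angleMeasure α β z (Metric.ball 0 r) := by
  rw [angleMeasure, Measure.map_apply (continuous_boundaryParam hαβ).measurable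
    Metric.isOpen_ball.measurableSet, boundaryParam_preimage_ball hαβ hr]
  refine le_halfPlaneMeasure_Ioo (angleReduction_im_pos hβ hz) (by positivity) ?_
  rw [norm_angleReduction hβ hz]
  exact Real.rpow_le_rpow hr hzr (angleExponent_pos hαβ).le

theorem measurable_angleReduction (α β : ℝ) : Measurable (angleReduction α β) := by
  unfold angleReduction
  exact Complex.measurable_exp.comp (((Complex.measurable_log.comp
    (measurable_id.mul_const _).neg).add_const _).const_mul _)

theorem measurable_angleMeasure {α β : ℝ} (hαβ : α < β) {B : Set ℂ} (hB : MeasurableSet B) :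
    Measurable fun z => angleMeasure α β z B := by
  have hb := (continuous_boundaryParam hαβ).measurable
  have e : (fun z => angleMeasure α β z B) = fun z => ∫⁻ s in boundaryParam α β ⁻¹' B,
      ENNReal.ofReal (halfPlaneKernel (angleReduction α β z) s) := by
    ext z
    rw [angleMeasure, Measure.map_apply hb hB, halfPlaneMeasure, withDensity_apply _ (hb hB)]
  rw [e]
  have hm : Measurable fun q : ℂ × ℝ =>
      ENNReal.ofReal (halfPlaneKernel (angleReduction α β q.1) q.2) :=
    (measurable_halfPlaneKernel.comp (((measurable_angleReduction α β).comp
      measurable_fst).prodMk measurable_snd)).ennreal_ofReal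
  exact hm.lintegral_prod_right'

/-! ### The balayage kernel -/

open Classical in
/-- The measures `ω(z, ·; ℂ ∖ S)` on the plane. -/
def balayageKernel (S : Set ℂ) (z : ℂ) : Measure ℂ :=
  if z ∈ S then Measure.dirac z
  else (harmonicMeasure (connectedComponentIn Sᶜ z) z).comap (fun w : ℂ => (w : OnePoint ℂ))

theorem omega_eq_balayageKernel (S : Set ℂ) (z : ℂ) (B : Set ℂ) :
    omega S z B = balayageKernel S z B := by
  unfold omega balayageKernel
  split_ifs with h
  · rfl
  · rw [measurableEmbedding_coe_sphere.comap_apply]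

theorem balayageKernel_of_mem {S : Set ℂ} {z : ℂ} (hz : z ∈ S) :
    balayageKernel S z = Measure.dirac z := by
  rw [balayageKernel, if_pos hz]

theorem balayageKernel_of_mem_openAngle {S : Set ℂ} {α β : ℝ} (h : IsComplementaryAngle S α β)
    {z : ℂ} (hz : z ∈ openAngle α β) : balayageKernel S z = angleMeasure α β z := by
  rw [balayageKernel, if_neg (h.subset_compl hz), h.eq_connectedComponentIn hz,
    harmonicMeasure_openAngle h.1 h.2.1 hz, measurableEmbedding_coe_sphere.comap_map]

theorem isProbabilityMeasure_balayageKernel {S : Set ℂ} (hS : IsClosedRaySystem S) (z : ℂ) :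
    IsProbabilityMeasure (balayageKernel S z) := by
  by_cases hz : z ∈ S
  · rw [balayageKernel_of_mem hz]; infer_instance
  · obtain ⟨_, ⟨α, β, h, rfl⟩, hzA⟩ := exists_mem_complementaryAngles hS hz
    rw [balayageKernel_of_mem_openAngle h hzA]
    exact isProbabilityMeasure_angleMeasure h.1 h.2.1 hzA

/-- The plane is the union of S and countably many open angles. On each of these pieces the kernel
is explicit and measurable. -/
theorem measurable_balayageKernel {S : Set ℂ} (hS : IsClosedRaySystem S) :
    Measurable (balayageKernel S) := by
  refine Measure.measurable_of_measurable_coe _ fun B hB E hE => ?_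
  have e : (fun z => balayageKernel S z B) ⁻¹' E
      = (S ∩ (fun z => Measure.dirac z B) ⁻¹' E) ∪
        ⋃ A ∈ complementaryAngles S, A ∩ (fun z => balayageKernel S z B) ⁻¹' E := by
    ext z
    simp only [Set.mem_union, Set.mem_inter_iff, Set.mem_preimage, Set.mem_iUnion, exists_prop]
    constructor
    · intro h
      by_cases hz : z ∈ S
      · rw [balayageKernel_of_mem hz] at h
        exact Or.inl ⟨hz, h⟩
      · obtain ⟨A, hA, hzA⟩ := exists_mem_complementaryAngles hS hz
        exact Or.inr ⟨A, hA, hzA, h⟩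
    · rintro (⟨hz, h⟩ | ⟨A, -, -, h⟩)
      · rwa [balayageKernel_of_mem hz]
      · exact h
  rw [e]
  refine (hS.1.measurableSet.inter ?_).union
    (MeasurableSet.biUnion (countable_complementaryAngles S) ?_)
  · exact Measure.measurable_coe hB |>.comp Measure.measurable_dirac hE
  · rintro A ⟨α, β, h, rfl⟩
    have e2 : openAngle α β ∩ (fun z => balayageKernel S z B) ⁻¹' E
        = openAngle α β ∩ (fun z => angleMeasure α β z B) ⁻¹' E := by
      ext z
      refine and_congr_right fun hz => ?_
      rw [Set.mem_preimage, balayageKernel_of_mem_openAngle h hz, Set.mem_preimage]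
    rw [e2]
    exact (isOpen_openAngle h.2.1).measurableSet.inter (measurable_angleMeasure h.1 hB hE)

/-! ### Growth -/

theorem exists_bound_of_typeAtInfty_lt_top {p : ℝ} {ν : Measure ℂ} (h : typeAtInfty p ν < ⊤) :
    ∃ C : ENNReal, C ≠ ⊤ ∧ ∃ r₁ : ℝ, 0 < r₁ ∧ ∀ r, r₁ ≤ r →
      ν (Metric.closedBall 0 r) ≤ C * ENNReal.ofReal (r ^ p) := by
  obtain ⟨C, hC, hCt⟩ := exists_between h
  refine ⟨C, hCt.ne, ?_⟩
  obtain ⟨r₁, hr₁⟩ := eventually_atTop.1 (eventually_lt_of_limsup_lt hC)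
  refine ⟨max r₁ 1, by positivity, fun r hr => ?_⟩
  have hr0 : 0 < r := one_pos.trans_le ((le_max_right _ _).trans hr)
  have := (hr₁ r ((le_max_left _ _).trans hr)).le
  exact (ENNReal.div_le_iff (ENNReal.ofReal_pos.2 (Real.rpow_pos_of_pos hr0 p)).ne'
    ENNReal.ofReal_ne_top).1 this

theorem typeAtInfty_lt_top_of_bound {p : ℝ} {ν : Measure ℂ} {C : ENNReal} (hC : C ≠ ⊤) {r₁ : ℝ}
    (h : ∀ r, r₁ ≤ r → ν (Metric.closedBall 0 r) ≤ C * ENNReal.ofReal (r ^ p)) :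
    typeAtInfty p ν < ⊤ := by
  refine lt_of_le_of_lt (limsup_le_of_le (a := C) (by isBoundedDefault) ?_) hC.lt_top
  filter_upwards [eventually_ge_atTop r₁] with r hr
  exact ENNReal.div_le_of_le_mul (h r hr)

/-- On the annulus 2^k r ≤ |z| < 2^(k+1) r the integrand is at most 2^(−kq), and the mass is at most
C (2^(k+1) r)^p. The terms are dominated by a geometric series of ratio 2^(p−q) < 1. -/
theorem exists_bound_lintegral_tail {p q : ℝ} (hq : 0 ≤ q) (hpq : p < q) {ν : Measure ℂ}
    {C : ENNReal} (hC : C ≠ ⊤) {r₁ : ℝ} (hr₁ : 0 < r₁)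
    (h : ∀ r, r₁ ≤ r → ν (Metric.closedBall 0 r) ≤ C * ENNReal.ofReal (r ^ p)) :
    ∃ C' : ENNReal, C' ≠ ⊤ ∧ ∀ r, r₁ ≤ r →
      ∫⁻ z in (Metric.closedBall 0 r)ᶜ, ENNReal.ofReal ((r / ‖z‖) ^ q) ∂ν
        ≤ C' * ENNReal.ofReal (r ^ p) := by
  set x : ENNReal := ENNReal.ofReal (2 ^ (p - q)) with hx
  have hx1 : x < 1 := by
    rw [hx, ENNReal.ofReal_lt_one]
    exact Real.rpow_lt_one_of_one_lt_of_neg one_lt_two (by linarith)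
  refine ⟨C * ENNReal.ofReal (2 ^ p) * (1 - x)⁻¹, ?_, fun r hr => ?_⟩
  · refine ENNReal.mul_ne_top (ENNReal.mul_ne_top hC ENNReal.ofReal_ne_top) ?_
    exact ENNReal.inv_ne_top.2 (tsub_pos_of_lt hx1).ne'
  have hr0 : 0 < r := hr₁.trans_le hr
  have hpt : ∀ z ∈ (Metric.closedBall (0 : ℂ) r)ᶜ, ENNReal.ofReal ((r / ‖z‖) ^ q)
      ≤ ∑' k : ℕ, (Metric.closedBall (0 : ℂ) (2 ^ (k + 1) * r)).indicator
        (fun _ => ENNReal.ofReal (((2 : ℝ) ^ k)⁻¹ ^ q)) z := by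
    intro z hz
    have hz1 : r < ‖z‖ := by simpa using hz
    obtain ⟨k, hk1, hk2⟩ := exists_nat_pow_near (one_le_div hr0 |>.2 hz1.le) one_lt_two
    refine le_trans ?_ (ENNReal.le_tsum k)
    rw [le_div_iff₀ hr0] at hk1
    rw [div_lt_iff₀ hr0] at hk2
    rw [Set.indicator_of_mem (mem_closedBall_zero_iff.2 hk2.le)]
    refine ENNReal.ofReal_le_ofReal (Real.rpow_le_rpow (by positivity) ?_ hq)
    rw [div_le_iff₀ (hr0.trans hz1), inv_mul_eq_div, le_div_iff₀ (by positivity)]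
    linarith
  calc _ ≤ ∫⁻ z in (Metric.closedBall 0 r)ᶜ, ∑' k : ℕ,
          (Metric.closedBall (0 : ℂ) (2 ^ (k + 1) * r)).indicator
            (fun _ => ENNReal.ofReal (((2 : ℝ) ^ k)⁻¹ ^ q)) z ∂ν :=
        setLIntegral_mono' Metric.isClosed_closedBall.measurableSet.compl hpt
    _ ≤ ∫⁻ z, ∑' k : ℕ, (Metric.closedBall (0 : ℂ) (2 ^ (k + 1) * r)).indicator
            (fun _ => ENNReal.ofReal (((2 : ℝ) ^ k)⁻¹ ^ q)) z ∂ν := setLIntegral_le_lintegral _ _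
    _ = ∑' k : ℕ, ENNReal.ofReal (((2 : ℝ) ^ k)⁻¹ ^ q)
          * ν (Metric.closedBall (0 : ℂ) (2 ^ (k + 1) * r)) := by
        rw [lintegral_tsum fun k => (measurable_const.indicator
          Metric.isClosed_closedBall.measurableSet).aemeasurable]
        congr 1
        ext k
        rw [lintegral_indicator_const Metric.isClosed_closedBall.measurableSet]
    _ ≤ ∑' k : ℕ, C * ENNReal.ofReal (2 ^ p) * ENNReal.ofReal (r ^ p) * x ^ k := by
        refine ENNReal.tsum_le_tsum fun k => ?_
        have h2k : (1 : ℝ) ≤ 2 ^ (k + 1) := one_le_pow₀ one_le_two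
        refine (mul_le_mul_right (h _ (hr.trans (le_mul_of_one_le_left hr0.le h2k))) _).trans
          (le_of_eq ?_)
        have e : ((2 : ℝ) ^ k)⁻¹ ^ q * (2 ^ (k + 1) * r) ^ p
            = 2 ^ p * r ^ p * (2 ^ (p - q)) ^ k := by
          rw [Real.mul_rpow (by positivity) hr0.le, Real.inv_rpow (by positivity),
            ← Real.rpow_natCast_mul zero_le_two, ← Real.rpow_natCast_mul zero_le_two,
            ← Real.rpow_mul_natCast zero_le_two, ← Real.rpow_neg zero_le_two]
          have : (2 : ℝ) ^ (((k + 1 : ℕ) : ℝ) * p) = 2 ^ p * 2 ^ (k * p) := by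
            rw [← Real.rpow_add two_pos]; push_cast; ring_nf
          have h3 : (2 : ℝ) ^ ((p - q) * k) = 2 ^ (k * p) * 2 ^ (-(k * q)) := by
            rw [← Real.rpow_add two_pos]; ring_nf
          rw [this, h3]; ring
        have e' := congrArg ENNReal.ofReal e
        rw [ENNReal.ofReal_mul (by positivity), ENNReal.ofReal_mul (by positivity),
          ENNReal.ofReal_mul (by positivity), ENNReal.ofReal_pow (by positivity)] at e'
        rw [mul_left_comm, e']
        ring
    _ = _ := by
        rw [ENNReal.tsum_mul_left, ENNReal.tsum_geometric]
        ring

/-! ### The Blaschke condition and balayage -/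

/-- Outside D(r₀) the Blaschke integrand is at most a constant, depending on the angle, times ω(z,
D(r₀)). -/
theorem blaschkeOutside_of_lintegral_omega_lt_top {S : Set ℂ} {ν : Measure ℂ} {r₀ : ℝ}
    (hr₀ : 0 < r₀) (h : ∫⁻ z, omega S z (Metric.ball 0 r₀) ∂ν < ⊤) : BlaschkeOutside ν S := by
  intro α β hA
  refine ⟨r₀, hr₀, ?_⟩
  have hc : 0 < r₀ ^ angleExponent α β / (2 * Real.pi) :=
    div_pos (Real.rpow_pos_of_pos hr₀ _) Real.two_pi_pos
  have hle : ENNReal.ofReal (r₀ ^ angleExponent α β / (2 * Real.pi)) *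
      ∫⁻ z in openAngle α β \ Metric.ball 0 r₀, ENNReal.ofReal (-(1 / angleReduction α β z).im) ∂ν
      ≤ ∫⁻ z, omega S z (Metric.ball 0 r₀) ∂ν := by
    rw [← lintegral_const_mul' _ _ ENNReal.ofReal_ne_top]
    refine le_trans (setLIntegral_mono' ((isOpen_openAngle hA.2.1).measurableSet.diff
      Metric.isOpen_ball.measurableSet) fun z hz => ?_) (setLIntegral_le_lintegral _ _)
    rw [← ENNReal.ofReal_mul hc.le, omega_eq_balayageKernel,
      balayageKernel_of_mem_openAngle hA hz.1]
    exact le_angleMeasure_ball hA.1 hA.2.1 hz.1 hr₀.le (by simpa using hz.2)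
  exact ENNReal.lt_top_of_mul_ne_top_right (hle.trans_lt h).ne (ENNReal.ofReal_pos.2 hc).ne'

theorem angleExponent_le_iff {α β : ℝ} (h : α < β) (p : ℝ) :
    angleExponent α β ≤ p ↔ Real.pi ≤ p * (β - α) := by
  rw [angleExponent, div_le_iff₀ (sub_pos.2 h)]

/-- The exponents above `p` of the complementary angles are bounded away from `p`. -/
theorem exists_exponent_gap (S : Set ℂ) {p : ℝ} (hp : 0 ≤ p) {a b : Set ℂ → ℝ}
    (hab : ∀ A ∈ complementaryAngles S,
      IsComplementaryAngle S (a A) (b A) ∧ A = openAngle (a A) (b A)) :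
    ∃ q, p < q ∧ ∀ A ∈ complementaryAngles S,
      angleExponent (a A) (b A) ≤ p ∨ q ≤ angleExponent (a A) (b A) := by
  -- K consists of the angles with exponent in (p, p + 1]. It is finite because such angles are wide
  -- for p + 1, and q is the least of their exponents and p + 1.
  set K : Set (Set ℂ) := wideAngles S (p + 1) ∩ {A | p < angleExponent (a A) (b A)} with hK
  have hfin : (insert (p + 1) ((fun A => angleExponent (a A) (b A)) '' K)).Finite :=
    (((finite_wideAngles S (by linarith)).inter_of_left _).image _).insert _
  obtain ⟨q, hq, hmin⟩ := Set.exists_min_image _ id hfin (Set.insert_nonempty _ _)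
  refine ⟨q, ?_, fun A hA => ?_⟩
  · rcases hq with rfl | ⟨A, hA, rfl⟩
    · linarith
    · exact hA.2
  · by_cases h1 : angleExponent (a A) (b A) ≤ p
    · exact Or.inl h1
    · refine Or.inr ?_
      obtain ⟨hc, hA'⟩ := hab A hA
      by_cases h2 : angleExponent (a A) (b A) ≤ p + 1
      · exact hmin _ (Or.inr ⟨A, ⟨⟨a A, b A, hc, (angleExponent_le_iff hc.1 _).1 h2, hA'⟩,
          not_le.1 h1⟩, rfl⟩)
      · exact (hmin _ (Or.inl rfl)).trans (not_le.1 h2).le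

theorem exists_bound_lintegral_balayageKernel {S : Set ℂ} (hS : IsClosedRaySystem S) {p : ℝ}
    (hp : 0 ≤ p) {ν : Measure ℂ} (hν : typeAtInfty p ν < ⊤)
    (hB : ∀ α β : ℝ, IsComplementaryAngle S α β → Real.pi ≤ p * (β - α) →
      BlaschkeInAngle ν α β) :
    ∃ C : ENNReal, C ≠ ⊤ ∧ ∃ r₁ : ℝ, 0 < r₁ ∧ ∀ r, r₁ ≤ r →
      ∫⁻ z, balayageKernel S z (Metric.closedBall 0 r) ∂ν ≤ C * ENNReal.ofReal (r ^ p) := by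
  obtain ⟨C, hC, r₁, hr₁, hbound⟩ := exists_bound_of_typeAtInfty_lt_top hν
  -- A set A determines α and β only up to a common multiple of 2π. Fixing one pair for each A makes
  -- the sum below count every angle once.
  have hrep : ∀ A : Set ℂ, ∃ α β : ℝ, A ∈ complementaryAngles S →
      IsComplementaryAngle S α β ∧ A = openAngle α β := fun A => by
    by_cases h : A ∈ complementaryAngles S
    · obtain ⟨α, β, h1, h2⟩ := h
      exact ⟨α, β, fun _ => ⟨h1, h2⟩⟩
    · exact ⟨0, 0, fun h' => absurd h' h⟩
  choose a b hab using hrep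
  obtain ⟨q, hpq, hq⟩ := exists_exponent_gap S hp hab
  obtain ⟨C', hC', htail⟩ := exists_bound_lintegral_tail (hp.trans hpq.le) hpq hC hr₁ hbound
  set κ : Set ℂ → ℝ := fun A => angleExponent (a A) (b A) with hκ
  set g : Set ℂ → ℂ → ENNReal := fun A z => ENNReal.ofReal (-(1 / angleReduction (a A) (b A) z).im)
    with hg
  have hgm : ∀ A, Measurable (g A) := fun A =>
    (Complex.measurable_im.comp
      ((measurable_angleReduction (a A) (b A)).const_div 1)).neg.ennreal_ofReal
  have hGfin : {A ∈ complementaryAngles S | κ A ≤ p}.Finite := by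
    refine (finite_wideAngles S hp).subset fun A hA => ?_
    obtain ⟨hc, hA'⟩ := hab A hA.1
    exact ⟨a A, b A, hc, (angleExponent_le_iff hc.1 p).1 hA.2, hA'⟩
  set G := hGfin.toFinset with hG
  have hGmem : ∀ A, A ∈ G ↔ A ∈ complementaryAngles S ∧ κ A ≤ p := fun A => by simp [hG]
  have hBl : ∀ A : Set ℂ, ∃ R : ℝ, A ∈ G → 0 < R ∧
      ∫⁻ z in A \ Metric.ball 0 R, g A z ∂ν < ⊤ := fun A => by
    by_cases h : A ∈ G
    · obtain ⟨h1, h2⟩ := (hGmem A).1 h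
      obtain ⟨hc, hA'⟩ := hab A h1
      obtain ⟨R, hR, hI⟩ := hB _ _ hc ((angleExponent_le_iff hc.1 p).1 h2)
      rw [← hA'] at hI
      exact ⟨R, fun _ => ⟨hR, hI⟩⟩
    · exact ⟨0, fun h' => absurd h' h⟩
  choose R hR using hBl
  obtain ⟨R₀, hR₀⟩ : ∃ R₀ : ℝ, ∀ A ∈ G, R A ≤ R₀ := by
    obtain ⟨R₀, h⟩ := (G.finite_toSet.image R).bddAbove
    exact ⟨R₀, fun A hA => h ⟨A, hA, rfl⟩⟩
  set c := ENNReal.ofReal (8 / Real.pi) with hc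
  -- The three terms come from the disc of radius 4r, from the wide angles, and from the tail in the
  -- narrow ones. Taking r ≥ 1 allows r^κ ≤ r^p, and r ≥ R₀ puts all points beyond 4r in the range
  -- of the Blaschke integrals.
  refine ⟨C * ENNReal.ofReal (4 ^ p) + (∑ A ∈ G, c * ∫⁻ z in A \ Metric.ball 0 (R A), g A z ∂ν)
    + c * C', ?_, max r₁ (max 1 R₀), lt_max_of_lt_left hr₁, fun r hr => ?_⟩
  · refine ENNReal.add_ne_top.2 ⟨ENNReal.add_ne_top.2 ⟨ENNReal.mul_ne_top hC ENNReal.ofReal_ne_top,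
      ENNReal.sum_ne_top.2 fun A hA => ENNReal.mul_ne_top ENNReal.ofReal_ne_top (hR A hA).2.ne⟩,
      ENNReal.mul_ne_top ENNReal.ofReal_ne_top hC'⟩
  have hrr₁ : r₁ ≤ r := (le_max_left _ _).trans hr
  have hr1 : 1 ≤ r := ((le_max_left _ _).trans (le_max_right _ _)).trans hr
  have hrR : R₀ ≤ r := ((le_max_right _ _).trans (le_max_right _ _)).trans hr
  have hr0 : 0 < r := one_pos.trans_le hr1
  have hAm : ∀ A ∈ G, MeasurableSet (A \ Metric.ball 0 (R A)) := fun A hA => by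
    obtain ⟨hcA, hA'⟩ := hab A ((hGmem A).1 hA).1
    rw [hA']
    exact (isOpen_openAngle hcA.2.1).measurableSet.diff Metric.isOpen_ball.measurableSet
  have hcb : ∀ t : ℝ, MeasurableSet (Metric.closedBall (0 : ℂ) t) := fun t =>
    Metric.isClosed_closedBall.measurableSet
  -- A point beyond 4r is charged to the sum if its angle is wide and to the last term if it is
  -- narrow. If it lies in S, its Dirac mass misses the disc.
  have hpt : ∀ z, balayageKernel S z (Metric.closedBall 0 r)
      ≤ (Metric.closedBall (0 : ℂ) (4 * r)).indicator 1 z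
        + ∑ A ∈ G, (A \ Metric.ball 0 (R A)).indicator
          (fun z => c * ENNReal.ofReal (r ^ κ A) * g A z) z
        + (Metric.closedBall (0 : ℂ) r)ᶜ.indicator
          (fun z => c * ENNReal.ofReal ((r / ‖z‖) ^ q)) z := by
    intro z
    have := isProbabilityMeasure_balayageKernel hS z
    by_cases hz4 : z ∈ Metric.closedBall (0 : ℂ) (4 * r)
    · rw [Set.indicator_of_mem hz4, add_assoc]
      exact prob_le_one.trans le_self_add
    have hz4' : 4 * r < ‖z‖ := by simpa using hz4
    have hzr : z ∉ Metric.closedBall (0 : ℂ) r := by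
      rw [mem_closedBall_zero_iff]; linarith
    by_cases hzS : z ∈ S
    · rw [balayageKernel_of_mem hzS, Measure.dirac_apply' _ (hcb r), Set.indicator_of_notMem hzr]
      exact zero_le
    obtain ⟨A, hA, hzA⟩ := exists_mem_complementaryAngles hS hzS
    obtain ⟨hcA, hA'⟩ := hab A hA
    have hzA' : z ∈ openAngle (a A) (b A) := hA' ▸ hzA
    rw [balayageKernel_of_mem_openAngle hcA hzA']
    rcases hq A hA with hle | hle
    · have hAG : A ∈ G := (hGmem A).2 ⟨hA, hle⟩
      refine le_trans ?_ (le_add_right (le_add_left (Finset.single_le_sum (f := fun A =>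
        (A \ Metric.ball 0 (R A)).indicator (fun z => c * ENNReal.ofReal (r ^ κ A) * g A z) z)
        (fun _ _ => zero_le) hAG)))
      have hzR : z ∈ A \ Metric.ball 0 (R A) := ⟨hzA, by
        rw [mem_ball_zero_iff]; linarith [hR₀ A hAG]⟩
      simp only [Set.indicator_of_mem hzR]
      refine (angleMeasure_closedBall_le hcA.1 hcA.2.1 hzA' hr0.le hz4'.le).trans (le_of_eq ?_)
      rw [ENNReal.ofReal_mul (by positivity), ENNReal.ofReal_mul (by positivity)]
    · refine le_trans ?_ (le_add_left le_rfl)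
      rw [Set.indicator_of_mem hzr]
      exact angleMeasure_closedBall_le_rpow hcA.1 hcA.2.1 hzA' hr0 hz4'.le hle
  calc _ ≤ ∫⁻ z, ((Metric.closedBall (0 : ℂ) (4 * r)).indicator 1 z
        + ∑ A ∈ G, (A \ Metric.ball 0 (R A)).indicator
          (fun z => c * ENNReal.ofReal (r ^ κ A) * g A z) z
        + (Metric.closedBall (0 : ℂ) r)ᶜ.indicator
          (fun z => c * ENNReal.ofReal ((r / ‖z‖) ^ q)) z) ∂ν := lintegral_mono hpt
    _ = ν (Metric.closedBall 0 (4 * r))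
        + ∑ A ∈ G, c * ENNReal.ofReal (r ^ κ A) * ∫⁻ z in A \ Metric.ball 0 (R A), g A z ∂ν
        + c * ∫⁻ z in (Metric.closedBall 0 r)ᶜ, ENNReal.ofReal ((r / ‖z‖) ^ q) ∂ν := by
        have hcr : ∀ x : ℝ, c * ENNReal.ofReal x ≠ ⊤ := fun x =>
          ENNReal.mul_ne_top ENNReal.ofReal_ne_top ENNReal.ofReal_ne_top
        have hm1 : ∀ A ∈ G, Measurable ((A \ Metric.ball 0 (R A)).indicator
          (fun z => c * ENNReal.ofReal (r ^ κ A) * g A z)) := fun A hA =>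
          ((hgm A).const_mul _).indicator (hAm A hA)
        have hm0 : Measurable ((Metric.closedBall (0 : ℂ) (4 * r)).indicator
          (1 : ℂ → ENNReal)) := measurable_one.indicator (hcb _)
        have hm2 : Measurable fun z => (Metric.closedBall (0 : ℂ) (4 * r)).indicator
            (1 : ℂ → ENNReal) z + ∑ A ∈ G, (A \ Metric.ball 0 (R A)).indicator
            (fun z => c * ENNReal.ofReal (r ^ κ A) * g A z) z :=
          hm0.add (Finset.measurable_fun_sum G hm1)
        rw [lintegral_add_left hm2, lintegral_add_left hm0,
          lintegral_finsetSum' _ fun A hA => (hm1 A hA).aemeasurable,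
          lintegral_indicator_one (hcb _), lintegral_indicator (hcb r).compl,
          lintegral_const_mul' _ _ ENNReal.ofReal_ne_top]
        congr 2
        refine Finset.sum_congr rfl fun A hA => ?_
        rw [lintegral_indicator (hAm A hA), lintegral_const_mul' _ _ (hcr _)]
    _ ≤ C * ENNReal.ofReal (4 ^ p) * ENNReal.ofReal (r ^ p)
        + ∑ A ∈ G, (c * ∫⁻ z in A \ Metric.ball 0 (R A), g A z ∂ν) * ENNReal.ofReal (r ^ p)
        + c * (C' * ENNReal.ofReal (r ^ p)) := by
        refine add_le_add (add_le_add ?_ (Finset.sum_le_sum fun A hA => ?_)) ?_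
        · refine (hbound (4 * r) (by linarith)).trans (le_of_eq ?_)
          rw [Real.mul_rpow (by norm_num) hr0.le, ENNReal.ofReal_mul (by positivity), mul_assoc]
        -- For a wide angle κ ≤ p, hence r^κ ≤ r^p as r ≥ 1.
        · rw [mul_right_comm]
          gcongr
          exact ((hGmem A).1 hA).2
        · gcongr
          exact htail r hrr₁
    _ = _ := by
        rw [← Finset.sum_mul]
        ring

/-- The candidate is ν integrated against the kernel. The growth estimate on large discs gives both
local finiteness and finite type. -/
theorem exists_balayage {S : Set ℂ} (hS : IsClosedRaySystem S) {p : ℝ}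
    (hp : 0 ≤ p) {ν : Measure ℂ} (hν : typeAtInfty p ν < ⊤)
    (hB : ∀ α β : ℝ, IsComplementaryAngle S α β → Real.pi ≤ p * (β - α) →
      BlaschkeInAngle ν α β) :
    ∃ μ : Measure ℂ, IsBalayage S ν μ ∧ typeAtInfty p μ < ⊤ := by
  obtain ⟨C, hC, r₁, hr₁, hbound⟩ := exists_bound_lintegral_balayageKernel hS hp hν hB
  have hm := measurable_balayageKernel hS
  have happ : ∀ B : Set ℂ, MeasurableSet B →
      ν.bind (balayageKernel S) B = ∫⁻ z, balayageKernel S z B ∂ν := fun B hB =>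
    Measure.bind_apply hB hm.aemeasurable
  have hb : ∀ r, r₁ ≤ r →
      ν.bind (balayageKernel S) (Metric.closedBall 0 r) ≤ C * ENNReal.ofReal (r ^ p) :=
    fun r hr => (happ _ Metric.isClosed_closedBall.measurableSet).le.trans (hbound r hr)
  refine ⟨ν.bind (balayageKernel S), ⟨⟨fun K hK => ?_⟩, fun B hB => ?_⟩,
    typeAtInfty_lt_top_of_bound hC hb⟩
  · obtain ⟨t, ht⟩ := hK.isBounded.subset_closedBall 0
    refine (measure_mono (ht.trans (Metric.closedBall_subset_closedBall
      (le_max_left t r₁)))).trans_lt ((hb _ (le_max_right _ _)).trans_lt ?_)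
    exact ENNReal.mul_lt_top hC.lt_top ENNReal.ofReal_lt_top
  · simp only [happ B hB, omega_eq_balayageKernel]

theorem IsBalayage.lintegral_omega_lt_top {S : Set ℂ} {ν μ : Measure ℂ} (h : IsBalayage S ν μ) :
    ∫⁻ z, omega S z (Metric.ball 0 1) ∂ν < ⊤ := by
  have := h.1
  rw [← h.2 _ Metric.isOpen_ball.measurableSet]
  exact measure_ball_lt_top

end Balayage

end

/-! ### The count of wide angles and the equivalence of the four conditions -/

theorem mainTheorem7 (S : Set ℂ) (hS : Balayage.IsClosedRaySystem S)
    (p : ℝ) (hp : 0 ≤ p)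
    (ν : MeasureTheory.Measure ℂ) [MeasureTheory.IsFiniteMeasureOnCompacts ν]
    (hν : Balayage.typeAtInfty p ν < ⊤) :
    ({A : Set ℂ | ∃ α β : ℝ, Balayage.IsComplementaryAngle S α β ∧
          Real.pi ≤ p * (β - α) ∧ A = Balayage.openAngle α β}.Finite ∧
      ({A : Set ℂ | ∃ α β : ℝ, Balayage.IsComplementaryAngle S α β ∧
          Real.pi ≤ p * (β - α) ∧ A = Balayage.openAngle α β}.ncard : ℝ) ≤ 2 * p) ∧
    List.TFAE [
      ∃ r₀ : ℝ, 0 < r₀ ∧ ∫⁻ z, Balayage.omega S z (Metric.ball 0 r₀) ∂ν < ⊤,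
      ∀ α β : ℝ, Balayage.IsComplementaryAngle S α β → Real.pi ≤ p * (β - α) →
        Balayage.BlaschkeInAngle ν α β,
      Balayage.BlaschkeOutside ν S,
      ∃ μ : MeasureTheory.Measure ℂ, Balayage.IsBalayage S ν μ ∧
        Balayage.typeAtInfty p μ < ⊤] := by
  refine ⟨⟨Balayage.finite_wideAngles S hp, Balayage.ncard_wideAngles_le S hp⟩, ?_⟩
  -- The cycle is (i) ⇒ (iii) ⇒ (ii) ⇒ (iv) ⇒ (i). The growth of ν enters in (ii) ⇒ (iv).
  tfae_have 1 → 3 := fun ⟨r₀, hr₀, h⟩ => Balayage.blaschkeOutside_of_lintegral_omega_lt_top hr₀ h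
  tfae_have 3 → 2 := fun h α β hA _ => h α β hA
  tfae_have 2 → 4 := fun h => Balayage.exists_balayage hS hp hν h
  tfae_have 4 → 1 := fun ⟨_, h, _⟩ => ⟨1, one_pos, h.lintegral_omega_lt_top⟩
  tfae_finish
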